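/- **Setup.** Let $\Sigma_0\in\mathbb{R}^{p_1\times p_2}$ have rank $r$ and singular value decomposition $\Sigma_0=V_1\,\mathrm{diag}(s_1,\dots,s_r)V_2^{T}$ with $V_1^TV_1=V_2^TV_2=I_r$ and $s_1\ge\dots\ge s_r>0$, and suppose that any $r$ rows of $V_2$ are linearly independent. For each $m,n$ let $\tau_0:[m]\to[p_1]$ and $\gamma_0:[n]\to[p_2]$ be cluster assignments (depending on $m$, resp. $n$, only) such that, for probability vectors $w,\pi$ with positive entries, $\frac1m\sum_i 1\{\tau_0(i)=s\}\to w_s$ and $\frac1n\sum_j1\{\gamma_0(j)=t\}\to\pi_t$. One observes the $m\times n$ matrix $Y$ with $y_{ij}=[\Sigma_0]_{\tau_0(i)\gamma_0(j)}+e_{ij}$, where the $e_{ij}$ are independent, identically distributed, of mean $0$ and variance $\sigma^2>0$, and sub-Gaussian: $\mathbb{E}e^{ue_{ij}}\le e^{Ku^2/2}$ for all $u\in\mathbb{R}$, with $K$ not depending on $m,n$. All limits are for $\min(m,n)\to\infty$. **Coordinates.** Let $d=p_1r+(p_2-r)r$. For $\theta=[\mathrm{vec}(A)^T,\mathrm{vec}(M)^T]^T\in\mathbb{R}^d$,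 with $A\in\mathbb{R}^{(p_2-r)\times r}$ and $M\in\mathbb{R}^{p_1\times r}$, put $$\Sigma(\theta)=M\,U(A)^T,\quad U(A)=(I+X_A)(I-X_A)^{-1}I_{p_2\times r},\quad X_A=\begin{bmatrix}0&-A^T\\A&0\end{bmatrix},\quad I_{p_2\times r}=\begin{bmatrix}I_r\\0\end{bmatrix},$$ and let $\mathscr{T}=\{\theta:\|A\|_2<1\}$ ($\|\cdot\|_2$ the spectral norm). Let $$D\Sigma(\theta)=\big[\,K_{p_2p_1}(M\otimes I_{p_2})\,DU(A)\ \ \ U(A)\otimes I_{p_1}\big],\quad DU(A)=2\big[I_{p_2\times r}^T(I-X_A)^{-T}\otimes(I-X_A)^{-1}\big]\Gamma,$$ where $K_{p_2p_1}$ is the commutation matrix ($K_{p_2p_1}\mathrm{vec}(B)=\mathrm{vec}(B^T)$ for $B\in\mathbb{R}^{p_2\times p_1}$) and $\Gamma$ is the matrix with $\Gamma\,\mathrm{vec}(A)=\mathrm{vec}(X_A)$; this is the derivative of $\theta\mapsto\mathrm{vec}(\Sigma(\theta))$. For permutation matrices $\Pi_1\in\mathbb{R}^{p_1\times p_1}$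 and $\Pi_2\in\mathbb{R}^{p_2\times p_2}$ let $\theta_{0\Pi_1\Pi_2}$ be the element of $\mathscr{T}$ with $\Sigma(\theta_{0\Pi_1\Pi_2})=\Pi_1\Sigma_0\Pi_2^T$ and, with $D=D\Sigma(\theta_{0\Pi_1\Pi_2})$, let $$G(\Pi_1,\Pi_2)=(D^TD)^{-1}D^T(\Pi_2\otimes\Pi_1)\,\mathrm{diag}\Big\{\mathrm{vec}\Big[\frac{\sigma^2}{w_s\pi_t}\Big]_{s,t}\Big\}(\Pi_2^T\otimes\Pi_1^T)\,D\,(D^TD)^{-1}.$$ **Estimator.** Let $\hat\tau,\hat\gamma$ be (measurable) strongly consistent estimators of $\tau_0,\gamma_0$: for some sequences of permutations $(\omega_m)$ of $[p_1]$ and $(\iota_n)$ of $[p_2]$, $$\mathbb{P}\{d_H(\hat\tau,\omega_m\circ\tau_0)=0,\ d_H(\hat\gamma,\iota_n\circ\gamma_0)=0\}\to1,$$ with $d_H$ the Hamming distance. Let $$[\hat\Sigma]_{st}=\frac{\sum_{i,j}y_{ij}1\{\hat\tau(i)=s,\hat\gamma(j)=t\}}{\sum_{i,j}1\{\hat\tau(i)=s,\hat\gamma(j)=t\}},$$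 and let $\hat\theta_{mn}$ be a (measurable) least-squares estimator, i.e. almost surely $\hat\theta_{mn}$ is a minimizer of $\|\hat\Sigma-\Sigma(\theta)\|_F^2$ over $\theta\in\mathscr{T}$ whenever a minimizer exists. **Theorem.** For all permutation matrices $\Pi_1,\Pi_2$ the vector $\theta_{0\Pi_1\Pi_2}$ exists and is unique, and $G(\Pi_1,\Pi_2)$ is positive definite. The probability that a minimizer of $\|\hat\Sigma-\Sigma(\theta)\|_F^2$ over $\mathscr{T}$ exists tends to $1$. There are sequences of permutation matrices $(\Pi_{1m})_m\subset\mathbb{R}^{p_1\times p_1}$ and $(\Pi_{2n})_n\subset\mathbb{R}^{p_2\times p_2}$ such that $$\sqrt{mn}\;G(\Pi_{1m},\Pi_{2n})^{-1/2}\big(\hat\theta_{mn}-\theta_{0\Pi_{1m}\Pi_{2n}}\big)\xrightarrow{\ \mathcal{L}\ }\mathrm{N}(0_d,I_d).$$ -/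

import Mathlib

open Matrix Filter Topology MeasureTheory ProbabilityTheory
open scoped Kronecker NNReal

namespace Biclustering

noncomputable section

/-! ### Cayley parameterization of subspaces

`vec` is Mathlib's `Matrix.vec`: the entry of `vec M` at the index `(j, i)` is `M i j`, so that
coordinates are grouped by columns. -/

/-- The `p × r` matrix `I_{p × r}`, whose top `r × r` block is the identity and whose other
entries vanish. -/
def topEmbed (p r : ℕ) : Matrix (Fin p) (Fin r) ℝ :=
  of fun i j => if (i : ℕ) = (j : ℕ) then 1 else 0

/-- The `(p - r) × p` matrix `[0, I_{p-r}]`. -/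
def botProj (p r : ℕ) : Matrix (Fin (p - r)) (Fin p) ℝ :=
  of fun i j => if (j : ℕ) = r + (i : ℕ) then 1 else 0

/-- The `p × p` skew-symmetric block matrix with blocks `0`, `-Aᵀ` (first block row) and
`A`, `0` (second block row). -/
def cayleyX {p r : ℕ} (A : Matrix (Fin (p - r)) (Fin r) ℝ) : Matrix (Fin p) (Fin p) ℝ :=
  (botProj p r)ᵀ * A * (topEmbed p r)ᵀ - topEmbed p r * Aᵀ * botProj p r

/-- The Cayley parameterization `U = (I + X) (I - X)⁻¹ I_{p × r}`. -/
def cayleyU {p r : ℕ} (A : Matrix (Fin (p - r)) (Fin r) ℝ) : Matrix (Fin p) (Fin r) ℝ :=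
  (1 + cayleyX A) * (1 - cayleyX A)⁻¹ * topEmbed p r

/-- The commutation matrix: `commMatrix p q *ᵥ vec M = vec Mᵀ` for every `p × q` matrix `M`. -/
def commMatrix (p q : ℕ) : Matrix (Fin p × Fin q) (Fin q × Fin p) ℝ :=
  of fun a b => if a = b.swap then 1 else 0

/-- The matrix `Γ` with `Γ vec(A) = vec(X_A)`. -/
def cayleyGamma (p r : ℕ) : Matrix (Fin p × Fin p) (Fin r × Fin (p - r)) ℝ :=
  (1 - commMatrix p p) * (topEmbed p r ⊗ₖ (botProj p r)ᵀ)

/-- The derivative of the Cayley parameterization `vec(A) ↦ vec(U)`, as a matrix. -/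
def cayleyDU {p r : ℕ} (A : Matrix (Fin (p - r)) (Fin r) ℝ) :
    Matrix (Fin r × Fin p) (Fin r × Fin (p - r)) ℝ :=
  (2 : ℝ) • ((((topEmbed p r)ᵀ * ((1 - cayleyX A)⁻¹)ᵀ) ⊗ₖ (1 - cayleyX A)⁻¹) * cayleyGamma p r)

/-! ### Euclidean representation of rectangular low-rank matrices -/

/-- Coordinates of `θ = [vec(A)ᵀ, vec(M)ᵀ]ᵀ`; there are `(p₂ - r) r + p₁ r` of them. -/
abbrev ParamIdx (p₁ p₂ r : ℕ) : Type := (Fin r × Fin (p₂ - r)) ⊕ (Fin r × Fin p₁)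

/-- The Euclidean space `ℝ^d`, `d = (p₂ - r) r + p₁ r`. -/
abbrev Param (p₁ p₂ r : ℕ) : Type := EuclideanSpace ℝ (ParamIdx p₁ p₂ r)

variable {p₁ p₂ r : ℕ}

/-- The `(p₂ - r) × r` matrix `A` with `vec(A)` the first block of `θ`. -/
def matA (θ : Param p₁ p₂ r) : Matrix (Fin (p₂ - r)) (Fin r) ℝ :=
  of fun i j => θ (Sum.inl (j, i))

/-- The `p₁ × r` matrix `M` with `vec(M)` the second block of `θ`. -/
def matM (θ : Param p₁ p₂ r) : Matrix (Fin p₁) (Fin r) ℝ :=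
  of fun i j => θ (Sum.inr (j, i))

/-- `Σ(θ) = M Uᵀ`. -/
def sigmaMap (θ : Param p₁ p₂ r) : Matrix (Fin p₁) (Fin p₂) ℝ :=
  matM θ * (cayleyU (matA θ))ᵀ

open scoped Matrix.Norms.L2Operator in
/-- The spectral norm (largest singular value) of a matrix. -/
def specNorm {m n : ℕ} (A : Matrix (Fin m) (Fin n) ℝ) : ℝ := ‖A‖

/-- The parameter space: all `θ` with `‖A‖₂ < 1`. -/
def paramSpace (p₁ p₂ r : ℕ) : Set (Param p₁ p₂ r) := {θ | specNorm (matA θ) < 1}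

/-- The derivative `DΣ(θ) = [K (M ⊗ I) DU, U ⊗ I]` of `θ ↦ vec(Σ(θ))`, a
`p₁ p₂ × d` matrix. -/
def DSigma (θ : Param p₁ p₂ r) : Matrix (Fin p₂ × Fin p₁) (ParamIdx p₁ p₂ r) ℝ :=
  fromCols
    (commMatrix p₂ p₁ * (matM θ ⊗ₖ (1 : Matrix (Fin p₂) (Fin p₂) ℝ)) * cayleyDU (matA θ))
    (cayleyU (matA θ) ⊗ₖ (1 : Matrix (Fin p₁) (Fin p₁) ℝ))

/-- The coordinate vector in the parameter space of a matrix `S` (a junk value if there is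
none). -/
def coord (r : ℕ) (S : Matrix (Fin p₁) (Fin p₂) ℝ) : Param p₁ p₂ r :=
  Function.invFunOn sigmaMap (paramSpace p₁ p₂ r) S

/-- `Π₁ S Π₂ᵀ` for the permutation matrices `Π₁`, `Π₂` of two permutations. -/
def permuted (S : Matrix (Fin p₁) (Fin p₂) ℝ)
    (ω : Equiv.Perm (Fin p₁)) (ι : Equiv.Perm (Fin p₂)) : Matrix (Fin p₁) (Fin p₂) ℝ :=
  ω.permMatrix ℝ * S * (ι.permMatrix ℝ)ᵀ

/-- `S = V₁ diag(s) V₂ᵀ` is a (compact) singular value decomposition with `r` positive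
singular values in non-increasing order. -/
structure IsCompactSVD (S : Matrix (Fin p₁) (Fin p₂) ℝ) (V₁ : Matrix (Fin p₁) (Fin r) ℝ)
    (s : Fin r → ℝ) (V₂ : Matrix (Fin p₂) (Fin r) ℝ) : Prop where
  stiefel_left : V₁ᵀ * V₁ = 1
  stiefel_right : V₂ᵀ * V₂ = 1
  pos : ∀ k, 0 < s k
  antitone : Antitone s
  eq : S = V₁ * diagonal s * V₂ᵀ

/-! ### Least squares in biclustering -/

/-- The matrix of averages of the entries of `y` over the blocks of two cluster assignments. -/
def blockMean {m n : ℕ} (y : Matrix (Fin m) (Fin n) ℝ) (τ : Fin m → Fin p₁)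
    (γ : Fin n → Fin p₂) : Matrix (Fin p₁) (Fin p₂) ℝ :=
  of fun s t =>
    (∑ i, ∑ j, if τ i = s ∧ γ j = t then y i j else 0) /
      (∑ i, ∑ j, if τ i = s ∧ γ j = t then (1 : ℝ) else 0)

/-- The squared Frobenius norm. -/
def frobSq (S : Matrix (Fin p₁) (Fin p₂) ℝ) : ℝ := ∑ s, ∑ t, S s t ^ 2

/-- `θ` minimizes `‖S - Σ(θ)‖_F²` over the parameter space. -/
def IsLeastSquares (S : Matrix (Fin p₁) (Fin p₂) ℝ) (θ : Param p₁ p₂ r) : Prop :=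
  θ ∈ paramSpace p₁ p₂ r ∧ IsMinOn (fun θ' => frobSq (S - sigmaMap θ')) (paramSpace p₁ p₂ r) θ

/-- The sandwich covariance matrix
`(DᵀD)⁻¹ Dᵀ (Π₂ ⊗ Π₁) diag{vec([σ² / (w_s π_t)]_{st})} (Π₂ᵀ ⊗ Π₁ᵀ) D (DᵀD)⁻¹`,
where `D` is `DΣ` at the coordinates of `Π₁ Σ₀ Π₂ᵀ`. -/
def sandwichCov (r : ℕ) (S₀ : Matrix (Fin p₁) (Fin p₂) ℝ) (σ : ℝ) (w : Fin p₁ → ℝ)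
    (π : Fin p₂ → ℝ) (ω : Equiv.Perm (Fin p₁)) (ι : Equiv.Perm (Fin p₂)) :
    Matrix (ParamIdx p₁ p₂ r) (ParamIdx p₁ p₂ r) ℝ :=
  let D := DSigma (coord r (permuted S₀ ω ι))
  (Dᵀ * D)⁻¹ * Dᵀ * (ι.permMatrix ℝ ⊗ₖ ω.permMatrix ℝ)
    * diagonal (vec (of fun s t => σ ^ 2 / (w s * π t)))
    * ((ι.permMatrix ℝ)ᵀ ⊗ₖ (ω.permMatrix ℝ)ᵀ) * D * (Dᵀ * D)⁻¹

open scoped MatrixOrder in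
/-- `G^{-1/2}`: the inverse of the positive semidefinite square root. -/
def invSqrt {κ : Type} [Fintype κ] [DecidableEq κ] (G : Matrix κ κ ℝ) : Matrix κ κ ℝ :=
  (CFC.sqrt G)⁻¹

end

end Biclustering

open Biclustering

namespace Biclustering

noncomputable section

/-! ### Contractions -/

section Contraction

open scoped Matrix.Norms.L2Operator

/-! The argument has a geometric part, a deterministic least-squares part and a probabilistic part.

Geometry. With H = (1 + AᵀA)⁻¹ the frame U(A) has top block 2H - 1 and bottom block 2AH, and the top
block is positive definite exactly when ‖A‖ < 1. A frame with invertible top block becomes one with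
positive definite top block after exactly one rotation, by the polar decomposition. The condition on
the rows of V₂ makes the top block of Π₂V₂ invertible for every permutation, so each Π₁Σ₀Π₂ᵀ has
unique coordinates, with M of full column rank (`exists_cayleyU_eq_mul`,
`eq_and_eq_of_mul_cayleyU_transpose_eq`). At such a point DΣ is injective
(`DSigma_mulVec_injective`), hence G is positive definite.

Least squares. Identifiability extends to competitors with ‖A‖ = 1, and compactness then shows that
Σ(θ) can be near Σ(θ₀) only for θ near θ₀ (`comap_vecE_sigmaMap_inf_le`). Consequently, for data y
close to Σ(θ₀), a minimizer exists, and every minimizer equals θ₀ + (DᵀD)⁻¹Dᵀ(y - Σ(θ₀)) up to o(‖y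
- Σ(θ₀)‖). There are finitely many permutations, so this is uniform in them
(`exists_pos_leastSquares_linearization`).

Probability. When the clusters are recovered up to labels, the block mean matrix is a relabelling of
Σ₀ + W, with W the block means of the noise over the true clusters. Chebyshev's inequality bounds
√(mn) W in probability, which makes the linearization error negligible. The linear part is a
weighted sum of independent errors. Its weights need not converge, because the permutations may vary
with m and n, so the central limit theorem is proved as an explicit characteristic function bound
(`norm_integral_cexp_sum_sub_le`). Standardizing by G^{-1/2} fixes the limiting variance at tᵀt
whatever the permutations (`sum_sq_transpose_invSqrt_mulVec`), and Lévy's continuity theorem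
concludes. -/

lemma norm_toLp_mulVec_sq {m n : ℕ} (N : Matrix (Fin m) (Fin n) ℝ) (x : Fin n → ℝ) :
    x ⬝ᵥ ((Nᵀ * N) *ᵥ x) = ‖WithLp.toLp 2 (N *ᵥ x)‖ ^ 2 := by
  rw [← mulVec_mulVec, dotProduct_mulVec, vecMul_transpose, EuclideanSpace.norm_sq_eq]
  simp [dotProduct, sq]

lemma dotProduct_self_eq_norm_sq {n : ℕ} (x : Fin n → ℝ) :
    x ⬝ᵥ x = ‖WithLp.toLp 2 x‖ ^ 2 := by
  rw [EuclideanSpace.norm_sq_eq]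
  simp [dotProduct, sq]

lemma norm_toLp_mulVec_le {m n : ℕ} (N : Matrix (Fin m) (Fin n) ℝ) (x : Fin n → ℝ) :
    ‖WithLp.toLp 2 (N *ᵥ x)‖ ≤ ‖N‖ * ‖WithLp.toLp 2 x‖ := by
  simpa using Matrix.l2_opNorm_mulVec N (WithLp.toLp 2 x)

lemma posDef_one_sub_of_norm_lt_one {n : ℕ} {N : Matrix (Fin n) (Fin n) ℝ} (hN : ‖N‖ < 1) :
    (1 - Nᵀ * N).PosDef := by
  refine PosDef.of_dotProduct_mulVec_pos ?_ fun x hx => ?_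
  · simp [IsHermitian, conjTranspose_eq_transpose_of_trivial]
  · have h0 : 0 < ‖WithLp.toLp 2 x‖ := by simpa using hx
    have h := norm_toLp_mulVec_le N x
    simp only [star_trivial, sub_mulVec, one_mulVec, dotProduct_sub, norm_toLp_mulVec_sq,
      dotProduct_self_eq_norm_sq]
    have : ‖WithLp.toLp 2 (N *ᵥ x)‖ < ‖WithLp.toLp 2 x‖ := by nlinarith
    have := norm_nonneg (WithLp.toLp 2 (N *ᵥ x))
    nlinarith

lemma posSemidef_one_sub_of_norm_le_one {n : ℕ} {N : Matrix (Fin n) (Fin n) ℝ} (hN : ‖N‖ ≤ 1) :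
    (1 - Nᵀ * N).PosSemidef := by
  refine PosSemidef.of_dotProduct_mulVec_nonneg ?_ fun x => ?_
  · simp [IsHermitian, conjTranspose_eq_transpose_of_trivial]
  · have h := norm_toLp_mulVec_le N x
    simp only [star_trivial, sub_mulVec, one_mulVec, dotProduct_sub, norm_toLp_mulVec_sq,
      dotProduct_self_eq_norm_sq]
    have h1 := norm_nonneg (WithLp.toLp 2 (N *ᵥ x))
    have h2 := norm_nonneg (WithLp.toLp 2 x)
    have : ‖WithLp.toLp 2 (N *ᵥ x)‖ ≤ ‖WithLp.toLp 2 x‖ := by nlinarith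
    nlinarith

/-- The unit sphere is compact, so the operator norm is attained, and strictness at a maximizer is
strictness of the norm. In dimension zero the sphere is empty and the norm is zero. -/
lemma norm_lt_one_of_posDef_one_sub {n : ℕ} {N : Matrix (Fin n) (Fin n) ℝ}
    (hN : (1 - Nᵀ * N).PosDef) : ‖N‖ < 1 := by
  rw [cstar_norm_def]
  set f := toEuclideanCLM (n := Fin n) (𝕜 := ℝ) N
  rcases (Metric.sphere (0 : EuclideanSpace ℝ (Fin n)) 1).eq_empty_or_nonempty with he | hne
  · refine lt_of_le_of_lt (ContinuousLinearMap.opNorm_le_of_unit_norm le_rfl fun x hx => ?_)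
      zero_lt_one
    exact absurd (by simpa using hx : x ∈ Metric.sphere (0 : EuclideanSpace ℝ (Fin n)) 1)
      (by simp [he])
  · obtain ⟨x, hx, hmax⟩ := (isCompact_sphere (0 : EuclideanSpace ℝ (Fin n)) 1).exists_isMaxOn hne
      (f := fun x => ‖f x‖) (by fun_prop)
    have hx1 : ‖x‖ = 1 := by simpa using hx
    have hle : ‖f‖ ≤ ‖f x‖ := ContinuousLinearMap.opNorm_le_of_unit_norm (norm_nonneg _)
      fun y hy => hmax (by simpa using hy)
    refine hle.trans_lt ?_
    have hx0 : x.ofLp ≠ 0 := by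
      intro h
      have : x = 0 := by ext i; simp [h]
      simp [this] at hx1
    have h := hN.dotProduct_mulVec_pos hx0
    simp only [star_trivial, sub_mulVec, one_mulVec, dotProduct_sub, norm_toLp_mulVec_sq,
      dotProduct_self_eq_norm_sq, WithLp.toLp_ofLp, hx1] at h
    have h2 : f x = WithLp.toLp 2 (N *ᵥ x.ofLp) := by
      ext i; simp [f]
    rw [h2]
    have := norm_nonneg (WithLp.toLp 2 (N *ᵥ x.ofLp))
    nlinarith

lemma specNorm_transpose_mul_self {m n : ℕ} (A : Matrix (Fin m) (Fin n) ℝ) :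
    ‖Aᵀ * A‖ = specNorm A ^ 2 := by
  rw [specNorm, sq, ← l2_opNorm_conjTranspose_mul_self, conjTranspose_eq_transpose_of_trivial]

lemma specNorm_nonneg {m n : ℕ} (A : Matrix (Fin m) (Fin n) ℝ) : 0 ≤ specNorm A :=
  norm_nonneg A

lemma continuous_specNorm {m n : ℕ} :
    Continuous (specNorm : Matrix (Fin m) (Fin n) ℝ → ℝ) :=
  continuous_norm

/-- Taking norms gives ‖X‖ ≤ ‖A‖²‖X‖. The A-component of a vector in the kernel of DΣ satisfies this
equation. -/
lemma eq_zero_of_eq_neg_mul_transpose_mul {m n : ℕ} {A X : Matrix (Fin m) (Fin n) ℝ}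
    (hA : specNorm A < 1) (h : Xᵀ = -(Aᵀ * X * Aᵀ)) : X = 0 := by
  have h1 : ‖Xᵀ‖ ≤ ‖Aᵀ‖ * ‖X‖ * ‖Aᵀ‖ := by
    rw [h, norm_neg]
    exact (l2_opNorm_mul _ _).trans (by gcongr; exact l2_opNorm_mul _ _)
  have h2 : ∀ Z : Matrix (Fin m) (Fin n) ℝ, ‖Zᵀ‖ = ‖Z‖ := fun Z => by
    rw [← conjTranspose_eq_transpose_of_trivial, l2_opNorm_conjTranspose]
  rw [h2, h2] at h1
  have hA' : ‖A‖ < 1 := hA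
  by_contra hX
  have : 0 < ‖X‖ := norm_pos_iff.mpr hX
  have h3 : ‖A‖ * ‖X‖ * ‖A‖ < ‖X‖ := by
    have h0 := norm_nonneg A
    have : ‖A‖ * ‖A‖ < 1 := by nlinarith
    nlinarith
  linarith

end Contraction

/-! ### The Cayley parameterization -/

section Cayley

variable {p r : ℕ}

lemma topEmbed_transpose_mul (hr : r ≤ p) : (topEmbed p r)ᵀ * topEmbed p r = 1 := by
  ext i j
  rw [mul_apply, Finset.sum_eq_single (Fin.castLE hr i)]
  · simp [topEmbed, one_apply, Fin.ext_iff]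
  · intro k _ hk
    have : (k : ℕ) ≠ i := fun h => hk (Fin.ext h)
    simp [topEmbed, this]
  · simp

lemma botProj_mul_transpose : botProj p r * (botProj p r)ᵀ = 1 := by
  ext i j
  rw [mul_apply, Finset.sum_eq_single ⟨r + i, by omega⟩]
  · simp [botProj, one_apply, Fin.ext_iff]
  · intro k _ hk
    have : (k : ℕ) ≠ r + i := fun h => hk (Fin.ext h)
    simp [botProj, this]
  · simp

lemma botProj_mul_topEmbed : botProj p r * topEmbed p r = 0 := by
  ext i j
  rw [mul_apply]
  refine Finset.sum_eq_zero fun k _ => ?_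
  simp only [botProj, topEmbed, of_apply, ite_mul, one_mul, zero_mul]
  split_ifs with h1 h2
  · omega
  · rfl
  · rfl

lemma topEmbed_transpose_mul_botProj_transpose : (topEmbed p r)ᵀ * (botProj p r)ᵀ = 0 := by
  rw [← transpose_mul, botProj_mul_topEmbed, transpose_zero]

lemma topEmbed_mul_transpose_add (hr : r ≤ p) :
    topEmbed p r * (topEmbed p r)ᵀ + (botProj p r)ᵀ * botProj p r = 1 := by
  ext i j
  simp only [Matrix.add_apply, mul_apply, topEmbed, botProj, transpose_apply, of_apply, one_apply,
    Fin.ext_iff]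
  by_cases hi : (i : ℕ) < r
  · rw [Finset.sum_eq_single ⟨i, hi⟩, Finset.sum_eq_zero]
    · simp [eq_comm]
    · intro k _
      rw [if_neg (by omega), zero_mul]
    · intro k _ hk
      rw [if_neg (fun h => hk (Fin.ext h.symm)), zero_mul]
    · simp
  · rw [Finset.sum_eq_zero, Finset.sum_eq_single ⟨i - r, by omega⟩]
    · have : r + ((i : ℕ) - r) = i := by omega
      simp [this, eq_comm]
    · intro k _ hk
      rw [if_neg (fun h => hk (Fin.ext (by simp only; omega))), zero_mul]
    · simp
    · intro k _
      rw [if_neg (by omega), zero_mul]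

/-- The matrix `(1 + AᵀA)⁻¹`. -/
def cayleyH (A : Matrix (Fin (p - r)) (Fin r) ℝ) : Matrix (Fin r) (Fin r) ℝ := (1 + Aᵀ * A)⁻¹

/-- The `p × r` matrix with blocks `1` and `A`. -/
def cayleyF (A : Matrix (Fin (p - r)) (Fin r) ℝ) : Matrix (Fin p) (Fin r) ℝ :=
  topEmbed p r + (botProj p r)ᵀ * A

variable (A : Matrix (Fin (p - r)) (Fin r) ℝ)

lemma posDef_one_add_transpose_mul : (1 + Aᵀ * A).PosDef :=
  PosDef.one.add_posSemidef
    (by simpa [conjTranspose_eq_transpose_of_trivial] using posSemidef_conjTranspose_mul_self A)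

lemma isUnit_det_one_add_transpose_mul : IsUnit (1 + Aᵀ * A).det :=
  (isUnit_iff_isUnit_det _).mp (posDef_one_add_transpose_mul A).isUnit

lemma mul_cayleyH : (1 + Aᵀ * A) * cayleyH A = 1 :=
  mul_nonsing_inv _ (isUnit_det_one_add_transpose_mul A)

lemma cayleyH_mul : cayleyH A * (1 + Aᵀ * A) = 1 :=
  nonsing_inv_mul _ (isUnit_det_one_add_transpose_mul A)

lemma cayleyH_transpose : (cayleyH A)ᵀ = cayleyH A := by
  simp [cayleyH, transpose_nonsing_inv]

lemma cayleyX_transpose : (cayleyX A)ᵀ = -cayleyX A := by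
  simp [cayleyX, Matrix.mul_assoc]

/-- The product (1 + X)(1 - X) equals 1 + XᵀX, which is positive definite. -/
lemma isUnit_one_sub_of_skew {n : Type*} [Fintype n] [DecidableEq n] {X : Matrix n n ℝ}
    (hX : Xᵀ = -X) : IsUnit (1 - X).det := by
  have h : (1 + X) * (1 - X) = 1 + Xᵀ * X := by rw [hX]; noncomm_ring
  have h2 : (1 + Xᵀ * X).PosDef := PosDef.one.add_posSemidef
    (by simpa [conjTranspose_eq_transpose_of_trivial] using posSemidef_conjTranspose_mul_self X)
  have h3 := (isUnit_iff_isUnit_det _).mp h2.isUnit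
  rw [← h, det_mul] at h3
  exact isUnit_of_mul_isUnit_right h3

lemma isUnit_det_one_sub_cayleyX : IsUnit (1 - cayleyX A).det :=
  isUnit_one_sub_of_skew (cayleyX_transpose A)

variable {A}

lemma topEmbed_transpose_mul_cayleyF (hr : r ≤ p) : (topEmbed p r)ᵀ * cayleyF A = 1 := by
  rw [cayleyF, Matrix.mul_add, topEmbed_transpose_mul hr, ← Matrix.mul_assoc,
    topEmbed_transpose_mul_botProj_transpose, Matrix.zero_mul, add_zero]

lemma botProj_mul_cayleyF : botProj p r * cayleyF A = A := by
  rw [cayleyF, Matrix.mul_add, botProj_mul_topEmbed, ← Matrix.mul_assoc,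
    botProj_mul_transpose, Matrix.one_mul, zero_add]

lemma cayleyF_transpose_mul_self (hr : r ≤ p) : (cayleyF A)ᵀ * cayleyF A = 1 + Aᵀ * A := by
  conv_lhs => enter [1]; rw [cayleyF]
  rw [transpose_add, transpose_mul, transpose_transpose, Matrix.add_mul, Matrix.mul_assoc,
    topEmbed_transpose_mul_cayleyF hr, botProj_mul_cayleyF]

lemma cayleyX_mul_topEmbed (hr : r ≤ p) : cayleyX A * topEmbed p r = (botProj p r)ᵀ * A := by
  rw [cayleyX, Matrix.sub_mul, Matrix.mul_assoc, topEmbed_transpose_mul hr,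
    Matrix.mul_assoc (topEmbed p r * Aᵀ), botProj_mul_topEmbed, Matrix.mul_one, Matrix.mul_zero,
    sub_zero]

lemma cayleyX_mul_botProj_transpose :
    cayleyX A * (botProj p r)ᵀ = -(topEmbed p r * Aᵀ) := by
  rw [cayleyX, Matrix.sub_mul, Matrix.mul_assoc, topEmbed_transpose_mul_botProj_transpose,
    Matrix.mul_assoc (topEmbed p r * Aᵀ), botProj_mul_transpose, Matrix.mul_one, Matrix.mul_zero, zero_sub]

/-- This yields the first r columns of (1 - X)⁻¹ in closed form, and with them both blocks of U. -/
lemma one_sub_cayleyX_mul_cayleyF (hr : r ≤ p) :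
    (1 - cayleyX A) * cayleyF A = topEmbed p r * (1 + Aᵀ * A) := by
  rw [cayleyF, Matrix.mul_add, ← Matrix.mul_assoc, Matrix.sub_mul, Matrix.sub_mul,
    cayleyX_mul_topEmbed hr, cayleyX_mul_botProj_transpose, Matrix.one_mul, Matrix.one_mul,
    Matrix.sub_mul, Matrix.mul_add, Matrix.neg_mul, Matrix.mul_one, Matrix.mul_assoc]
  abel

lemma inv_mul_topEmbed (hr : r ≤ p) :
    (1 - cayleyX A)⁻¹ * topEmbed p r = cayleyF A * cayleyH A := by
  have h := isUnit_det_one_sub_cayleyX A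
  have : topEmbed p r = (1 - cayleyX A) * (cayleyF A * cayleyH A) := by
    rw [← Matrix.mul_assoc, one_sub_cayleyX_mul_cayleyF hr, Matrix.mul_assoc, mul_cayleyH,
      Matrix.mul_one]
  conv_lhs => rw [this]
  rw [nonsing_inv_mul_cancel_left _ _ h]

lemma one_add_mul_inv_one_sub :
    (1 + cayleyX A) * (1 - cayleyX A)⁻¹ = (2 : ℝ) • (1 - cayleyX A)⁻¹ - 1 := by
  have h : (1 + cayleyX A) = (2 : ℝ) • (1 : Matrix (Fin p) (Fin p) ℝ) - (1 - cayleyX A) := by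
    rw [two_smul]; abel
  rw [h, Matrix.sub_mul, mul_nonsing_inv _ (isUnit_det_one_sub_cayleyX A), Matrix.smul_mul,
    Matrix.one_mul]

lemma cayleyU_eq_inv :
    cayleyU A = (2 : ℝ) • ((1 - cayleyX A)⁻¹ * topEmbed p r) - topEmbed p r := by
  rw [cayleyU, one_add_mul_inv_one_sub, Matrix.sub_mul, Matrix.smul_mul, Matrix.one_mul]

lemma cayleyU_eq (hr : r ≤ p) :
    cayleyU A = (2 : ℝ) • (cayleyF A * cayleyH A) - topEmbed p r := by
  rw [cayleyU_eq_inv, inv_mul_topEmbed hr]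

lemma topEmbed_transpose_mul_cayleyU (hr : r ≤ p) :
    (topEmbed p r)ᵀ * cayleyU A = (2 : ℝ) • cayleyH A - 1 := by
  rw [cayleyU_eq hr, Matrix.mul_sub, Matrix.mul_smul, ← Matrix.mul_assoc,
    topEmbed_transpose_mul_cayleyF hr, topEmbed_transpose_mul hr, Matrix.one_mul]

lemma botProj_mul_cayleyU (hr : r ≤ p) :
    botProj p r * cayleyU A = (2 : ℝ) • (A * cayleyH A) := by
  rw [cayleyU_eq hr, Matrix.mul_sub, Matrix.mul_smul, ← Matrix.mul_assoc,
    botProj_mul_cayleyF, botProj_mul_topEmbed, sub_zero]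

lemma cayleyU_transpose_mul_self (hr : r ≤ p) : (cayleyU A)ᵀ * cayleyU A = 1 := by
  have h1 : (cayleyF A)ᵀ * topEmbed p r = 1 := by
    rw [← transpose_transpose ((cayleyF A)ᵀ * topEmbed p r), transpose_mul, transpose_transpose,
      topEmbed_transpose_mul_cayleyF hr, transpose_one]
  have h2 : (cayleyU A)ᵀ * cayleyF A = 1 := by
    rw [cayleyU_eq hr, transpose_sub, transpose_smul, transpose_mul, Matrix.sub_mul,
      Matrix.smul_mul, Matrix.mul_assoc, cayleyF_transpose_mul_self hr, cayleyH_transpose,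
      cayleyH_mul, topEmbed_transpose_mul_cayleyF hr, two_smul, add_sub_cancel_right]
  have h3 : (cayleyU A)ᵀ * topEmbed p r = (2 : ℝ) • cayleyH A - 1 := by
    rw [← transpose_transpose ((cayleyU A)ᵀ * topEmbed p r), transpose_mul, transpose_transpose,
      topEmbed_transpose_mul_cayleyU hr, transpose_sub, transpose_smul, cayleyH_transpose,
      transpose_one]
  conv_lhs => enter [2]; rw [cayleyU_eq hr]
  rw [Matrix.mul_sub, Matrix.mul_smul, ← Matrix.mul_assoc, h2, h3, Matrix.one_mul]
  abel

/-- A matrix in the Stiefel manifold is determined by its two blocks. -/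
lemma eq_of_blocks (hr : r ≤ p) {k : Type*} {U V : Matrix (Fin p) k ℝ}
    (h1 : (topEmbed p r)ᵀ * U = (topEmbed p r)ᵀ * V) (h2 : botProj p r * U = botProj p r * V) :
    U = V := by
  have h : ∀ Z : Matrix (Fin p) k ℝ, Z = topEmbed p r * ((topEmbed p r)ᵀ * Z) +
      (botProj p r)ᵀ * (botProj p r * Z) := fun Z => by
    rw [← Matrix.mul_assoc, ← Matrix.mul_assoc, ← Matrix.add_mul, topEmbed_mul_transpose_add hr,
      Matrix.one_mul]
  rw [h U, h V, h1, h2]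

/-- The top block determines H, the bottom block then determines AH, and H is invertible. -/
lemma cayleyU_injective (hr : r ≤ p) :
    Function.Injective (cayleyU : Matrix (Fin (p - r)) (Fin r) ℝ → _) := by
  intro A A' h
  have h1 : cayleyH A = cayleyH A' := by
    have := congrArg (fun U => (topEmbed p r)ᵀ * U) h
    simp only [topEmbed_transpose_mul_cayleyU hr] at this
    exact smul_right_injective _ (two_ne_zero (α := ℝ)) (sub_left_injective this)
  have h2 : A * cayleyH A = A' * cayleyH A := by
    have := congrArg (fun U => botProj p r * U) h
    simp only [botProj_mul_cayleyU hr, ← h1] at this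
    exact smul_right_injective _ (two_ne_zero (α := ℝ)) this
  have := congrArg (fun Z => Z * (1 + Aᵀ * A)) h2
  simpa only [Matrix.mul_assoc, cayleyH_mul, Matrix.mul_one] using this

/-- The congruence by H carries positivity back and forth between 1 - (AᵀA)², which encodes the size
of ‖A‖, and the top block of U. -/
lemma two_smul_cayleyH_sub_one :
    (2 : ℝ) • cayleyH A - 1 =
      (cayleyH A)ᵀ * (1 - (Aᵀ * A)ᵀ * (Aᵀ * A)) * cayleyH A := by
  have h : (1 - (Aᵀ * A)ᵀ * (Aᵀ * A)) = (2 : ℝ) • (1 + Aᵀ * A) - (1 + Aᵀ * A) * (1 + Aᵀ * A) := by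
    simp only [transpose_mul, transpose_transpose, two_smul]
    noncomm_ring
  rw [h, cayleyH_transpose, Matrix.mul_sub, Matrix.sub_mul, Matrix.mul_smul, Matrix.smul_mul,
    Matrix.mul_assoc, mul_cayleyH, Matrix.mul_one, ← Matrix.mul_assoc, Matrix.mul_assoc, mul_cayleyH,
    cayleyH_mul, Matrix.mul_one]

lemma posDef_two_smul_cayleyH_sub_one (hA : specNorm A < 1) :
    ((2 : ℝ) • cayleyH A - 1).PosDef := by
  rw [two_smul_cayleyH_sub_one, ← conjTranspose_eq_transpose_of_trivial]
  refine PosDef.conjTranspose_mul_mul_same (posDef_one_sub_of_norm_lt_one ?_) ?_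
  · rw [specNorm_transpose_mul_self]
    have := specNorm_nonneg A
    nlinarith
  · refine mulVec_injective_of_isUnit ?_
    exact (posDef_one_add_transpose_mul A).inv.isUnit

lemma posSemidef_two_smul_cayleyH_sub_one (hA : specNorm A ≤ 1) :
    ((2 : ℝ) • cayleyH A - 1).PosSemidef := by
  rw [two_smul_cayleyH_sub_one, ← conjTranspose_eq_transpose_of_trivial]
  refine PosSemidef.conjTranspose_mul_mul_same (posSemidef_one_sub_of_norm_le_one ?_) _
  rw [specNorm_transpose_mul_self]
  have := specNorm_nonneg A
  nlinarith

lemma specNorm_lt_one_of_posDef (h : ((2 : ℝ) • cayleyH A - 1).PosDef) : specNorm A < 1 := by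
  have h1 : 1 - (Aᵀ * A)ᵀ * (Aᵀ * A) =
      (1 + Aᵀ * A)ᴴ * ((2 : ℝ) • cayleyH A - 1) * (1 + Aᵀ * A) := by
    have hG : (1 + Aᵀ * A)ᵀ = 1 + Aᵀ * A := by simp
    rw [two_smul_cayleyH_sub_one, conjTranspose_eq_transpose_of_trivial, hG, cayleyH_transpose]
    simp only [← Matrix.mul_assoc (1 + Aᵀ * A), mul_cayleyH, Matrix.one_mul]
    rw [Matrix.mul_assoc, cayleyH_mul, Matrix.mul_one]
  have h2 : (1 - (Aᵀ * A)ᵀ * (Aᵀ * A)).PosDef := by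
    rw [h1]
    exact h.conjTranspose_mul_mul_same
      (mulVec_injective_of_isUnit (posDef_one_add_transpose_mul A).isUnit)
  have h3 := norm_lt_one_of_posDef_one_sub h2
  rw [specNorm_transpose_mul_self] at h3
  exact (sq_lt_one_iff₀ (specNorm_nonneg A)).mp h3

open scoped MatrixOrder in
/-- Positive semidefinite matrices with the same square agree. -/
lemma posSemidef_eq_of_mul_self_eq {n : Type*} [Fintype n] [DecidableEq n] {S S' : Matrix n n ℝ}
    (hS : S.PosSemidef) (hS' : S'.PosSemidef) (h : S * S = S' * S') : S = S' := by
  exact (CFC.sqrt_unique h hS.nonneg).symm.trans (CFC.sqrt_unique rfl hS'.nonneg)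

/-- `M Uᵀ` determines `M` and `A`, if `M` has full column rank. -/
lemma eq_and_eq_of_mul_cayleyU_transpose_eq (hr : r ≤ p) {q : ℕ}
    {A A' : Matrix (Fin (p - r)) (Fin r) ℝ} {M M' : Matrix (Fin q) (Fin r) ℝ}
    (hM : IsUnit (Mᵀ * M).det) (hA : specNorm A < 1) (hA' : specNorm A' ≤ 1)
    (h : M' * (cayleyU A')ᵀ = M * (cayleyU A)ᵀ) : A' = A ∧ M' = M := by
  have hcancel : ∀ {k : Type} {Z Z' : Matrix (Fin r) k ℝ}, M * Z = M * Z' → Z = Z' := by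
    intro k Z Z' hZ
    have := congrArg (fun Y => (Mᵀ * M)⁻¹ * (Mᵀ * Y)) hZ
    simpa only [← Matrix.mul_assoc Mᵀ, nonsing_inv_mul_cancel_left _ _ hM] using this
  -- Since M is left-cancellable, the two factorizations differ by W = UᵀU', which turns out to be
  -- orthogonal with U' = UW.
  set U := cayleyU A with hU
  set U' := cayleyU A' with hU'
  have hUU : Uᵀ * U = 1 := cayleyU_transpose_mul_self hr
  have hUU' : U'ᵀ * U' = 1 := cayleyU_transpose_mul_self hr
  set W := Uᵀ * U' with hW
  have hM' : M' = M * W := by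
    have := congrArg (fun Y => Y * U') h
    simpa only [Matrix.mul_assoc, hUU', Matrix.mul_one] using this
  have hWW : W * Wᵀ = 1 := by
    refine hcancel ?_
    have := congrArg (fun Y => Y * U) h
    simp only [Matrix.mul_assoc, hUU, hM'] at this
    have hWt : Wᵀ = U'ᵀ * U := by rw [hW, transpose_mul, transpose_transpose]
    rw [hWt, this]
  have hWW' : Wᵀ * W = 1 := mul_eq_one_comm.mp hWW
  have hUW : U' = U * W := by
    have h1 : W * U'ᵀ = Uᵀ := hcancel (by rw [← Matrix.mul_assoc, ← hM', h])
    have h2 := congrArg (fun Y => Wᵀ * Y) h1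
    simp only [← Matrix.mul_assoc, hWW', Matrix.one_mul] at h2
    rw [← transpose_transpose U', h2, transpose_mul, transpose_transpose, transpose_transpose]
  -- On top blocks U' = UW reads S' = SW with S and S' positive: uniqueness in the polar
  -- decomposition forces W = 1. Semidefiniteness of S' suffices, which is why ‖A'‖ = 1 is allowed.
  set S := (2 : ℝ) • cayleyH A - 1 with hS
  set S' := (2 : ℝ) • cayleyH A' - 1 with hS'
  have hSpd : S.PosDef := posDef_two_smul_cayleyH_sub_one hA
  have hSpd' : S'.PosSemidef := posSemidef_two_smul_cayleyH_sub_one hA'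
  have hSS : S' = S * W := by
    rw [hS', ← topEmbed_transpose_mul_cayleyU hr, ← hU', hUW, ← Matrix.mul_assoc,
      topEmbed_transpose_mul_cayleyU hr]
  have hSt : Sᵀ = S := by simp [hS, cayleyH_transpose]
  have hSt' : S'ᵀ = S' := by simp [hS', cayleyH_transpose]
  have hSeq : S' = S := by
    refine posSemidef_eq_of_mul_self_eq hSpd' hSpd.posSemidef ?_
    conv_lhs => enter [2]; rw [← hSt']
    rw [hSS, transpose_mul, hSt, Matrix.mul_assoc, ← Matrix.mul_assoc W, hWW, Matrix.one_mul]
  have hW1 : W = 1 := by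
    have hSu : IsUnit S.det := (isUnit_iff_isUnit_det _).mp hSpd.isUnit
    have := congrArg (fun Y => S⁻¹ * Y) (hSS.symm.trans hSeq)
    simpa only [nonsing_inv_mul_cancel_left _ _ hSu, nonsing_inv_mul _ hSu] using this
  refine ⟨cayleyU_injective hr ?_, ?_⟩
  · rw [← hU, ← hU', hUW, hW1, Matrix.mul_one]
  · rw [hM', hW1, Matrix.mul_one]

open scoped MatrixOrder in
/-- An orthonormal frame whose top block is invertible can be rotated into the image of the
Cayley parameterization. -/
lemma exists_cayleyU_eq_mul (hr : r ≤ p) {V : Matrix (Fin p) (Fin r) ℝ} (hV : Vᵀ * V = 1)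
    (hT : IsUnit ((topEmbed p r)ᵀ * V).det) :
    ∃ (A : Matrix (Fin (p - r)) (Fin r) ℝ) (W : Matrix (Fin r) (Fin r) ℝ),
      specNorm A < 1 ∧ Wᵀ * W = 1 ∧ cayleyU A = V * W := by
  set C := (topEmbed p r)ᵀ * V with hC
  have hCu : IsUnit C := (isUnit_iff_isUnit_det _).mpr hT
  have hCC : (C * Cᵀ).PosDef := by
    have := PosDef.mul_conjTranspose_self C (vecMul_injective_of_isUnit hCu)
    rwa [conjTranspose_eq_transpose_of_trivial] at this
  -- S is the positive polar factor of C; the rotation W below is chosen so that CW = S.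
  set S := CFC.sqrt (C * Cᵀ) with hS
  have hSS : S * S = C * Cᵀ := CFC.sqrt_mul_sqrt_self _ hCC.posSemidef.nonneg
  have hSps : S.PosSemidef := (CFC.sqrt_nonneg _).posSemidef
  have hSu : IsUnit S.det := by
    have h := (isUnit_iff_isUnit_det _).mp hCC.isUnit
    rw [← hSS, det_mul] at h
    exact isUnit_of_mul_isUnit_left h
  have hSpd : S.PosDef := hSps.posDef_iff_isUnit.mpr ((isUnit_iff_isUnit_det _).mpr hSu)
  have hSt : Sᵀ = S := by
    have := hSps.isHermitian
    rwa [IsHermitian, conjTranspose_eq_transpose_of_trivial] at this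
  have hSit : (S⁻¹)ᵀ = S⁻¹ := by rw [transpose_nonsing_inv, hSt]
  set W := Cᵀ * S⁻¹ with hW
  have hCW : C * W = S := by
    rw [hW, ← Matrix.mul_assoc, ← hSS, mul_nonsing_inv_cancel_right _ _ hSu]
  have hWW : Wᵀ * W = 1 := by
    conv_lhs => enter [1]; rw [hW]
    rw [transpose_mul, transpose_transpose, Matrix.mul_assoc, hCW, hSit, nonsing_inv_mul _ hSu]
  set U := V * W with hU
  have hUU : Uᵀ * U = 1 := by
    rw [hU, transpose_mul, Matrix.mul_assoc, ← Matrix.mul_assoc Vᵀ, hV, Matrix.one_mul, hWW]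
  have hTU : (topEmbed p r)ᵀ * U = S := by rw [hU, ← Matrix.mul_assoc, ← hC, hCW]
  set R := botProj p r * U with hR
  have hRR : Rᵀ * R = 1 - S * S := by
    have h : Uᵀ * ((topEmbed p r * (topEmbed p r)ᵀ + (botProj p r)ᵀ * botProj p r) * U) = 1 := by
      rw [topEmbed_mul_transpose_add hr, Matrix.one_mul, hUU]
    rw [Matrix.add_mul, Matrix.mul_add, Matrix.mul_assoc, hTU, ← Matrix.mul_assoc,
      Matrix.mul_assoc (botProj p r)ᵀ, ← hR, ← Matrix.mul_assoc] at h
    have h1 : Uᵀ * topEmbed p r = S := by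
      rw [← hSt, ← hTU, transpose_mul _ U, transpose_transpose]
    have h2 : Uᵀ * (botProj p r)ᵀ = Rᵀ := by rw [hR, transpose_mul _ U]
    rw [h1, h2] at h
    rw [← h]; abel
  have hQpd : (1 + S).PosDef := PosDef.one.add_posSemidef hSps
  have hQu : IsUnit (1 + S).det := (isUnit_iff_isUnit_det _).mp hQpd.isUnit
  have hQt : ((1 + S)⁻¹)ᵀ = (1 + S)⁻¹ := by
    rw [transpose_nonsing_inv, transpose_add, transpose_one, hSt]
  -- This solves the block equations 2H - 1 = S and 2AH = R: the first gives 2H = 1 + S, the second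
  -- then gives A.
  set A := R * (1 + S)⁻¹ with hA
  have hG : 1 + Aᵀ * A = (2 : ℝ) • (1 + S)⁻¹ := by
    have h1 : Aᵀ * A = (1 + S)⁻¹ * (1 - S) := by
      have : Rᵀ * R = (1 - S) * (1 + S) := by rw [hRR]; noncomm_ring
      rw [hA, transpose_mul, hQt, Matrix.mul_assoc, ← Matrix.mul_assoc Rᵀ, this,
        mul_nonsing_inv_cancel_right _ _ hQu]
    have h2 : (1 - S) = (2 : ℝ) • (1 : Matrix (Fin r) (Fin r) ℝ) - (1 + S) := by
      rw [two_smul]; abel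
    rw [h1, h2, Matrix.mul_sub, nonsing_inv_mul _ hQu, Matrix.mul_smul, Matrix.mul_one]
    abel
  have hH : (2 : ℝ) • cayleyH A = 1 + S := by
    have h1 := mul_cayleyH A
    rw [hG, Matrix.smul_mul, ← Matrix.mul_smul] at h1
    have := congrArg (fun Y => (1 + S) * Y) h1
    simpa only [mul_nonsing_inv_cancel_left _ _ hQu, Matrix.mul_one] using this
  have hH' : (2 : ℝ) • cayleyH A - 1 = S := by rw [hH]; abel
  refine ⟨A, W, specNorm_lt_one_of_posDef (by rwa [hH']), hWW, ?_⟩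
  refine eq_of_blocks hr ?_ ?_
  · rw [topEmbed_transpose_mul_cayleyU hr, hH', hTU]
  · rw [botProj_mul_cayleyU hr, ← Matrix.mul_smul, hH, hA, nonsing_inv_mul_cancel_right _ _ hQu]

end Cayley

/-! ### The derivative of the parameterization -/

section Derivative

variable {p₁ p₂ p r : ℕ}

lemma commMatrix_mulVec_vec {p q : ℕ} (M : Matrix (Fin p) (Fin q) ℝ) :
    commMatrix p q *ᵥ vec M = vec Mᵀ := by
  ext a
  simp only [mulVec, dotProduct, commMatrix, of_apply, ite_mul, one_mul, zero_mul]
  rw [Finset.sum_eq_single a.swap]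
  · simp [vec]
  · intro b _ hb
    rw [if_neg]
    rintro rfl
    simp at hb
  · simp

lemma cayleyGamma_mulVec_vec (Z : Matrix (Fin (p - r)) (Fin r) ℝ) :
    cayleyGamma p r *ᵥ vec Z = vec (cayleyX Z) := by
  rw [cayleyGamma, ← mulVec_mulVec, kronecker_mulVec_vec, sub_mulVec, one_mulVec,
    commMatrix_mulVec_vec, ← vec_sub, cayleyX]
  simp [Matrix.mul_assoc]

/-- The directional derivative of the Cayley parameterization at `A` in the direction `Z`. -/
def cayleyTangent (A Z : Matrix (Fin (p - r)) (Fin r) ℝ) : Matrix (Fin p) (Fin r) ℝ :=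
  (2 : ℝ) • ((1 - cayleyX A)⁻¹ * cayleyX Z * (1 - cayleyX A)⁻¹ * topEmbed p r)

lemma cayleyDU_mulVec_vec (A Z : Matrix (Fin (p - r)) (Fin r) ℝ) :
    cayleyDU A *ᵥ vec Z = vec (cayleyTangent A Z) := by
  rw [cayleyDU, smul_mulVec, ← mulVec_mulVec, cayleyGamma_mulVec_vec, kronecker_mulVec_vec,
    ← vec_smul, cayleyTangent]
  simp [Matrix.mul_assoc]

lemma DSigma_mulVec (θ x : Param p₁ p₂ r) :
    DSigma θ *ᵥ x.ofLp =
      vec (matM x * (cayleyU (matA θ))ᵀ + matM θ * (cayleyTangent (matA θ) (matA x))ᵀ) := by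
  have h1 : x.ofLp ∘ Sum.inl = vec (matA x) := rfl
  have h2 : x.ofLp ∘ Sum.inr = vec (matM x) := rfl
  rw [DSigma, fromCols_mulVec, h1, h2, ← mulVec_mulVec, cayleyDU_mulVec_vec, ← mulVec_mulVec,
    kronecker_mulVec_vec, kronecker_mulVec_vec, Matrix.one_mul, Matrix.one_mul,
    commMatrix_mulVec_vec, vec_add, transpose_mul, transpose_transpose, add_comm]

/-- If `M` has full column rank and `A` is a strict contraction, the derivative is injective. -/
lemma DSigma_mulVec_injective (hr : r ≤ p₂) {θ : Param p₁ p₂ r}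
    (hM : IsUnit ((matM θ)ᵀ * matM θ).det) (hA : specNorm (matA θ) < 1) :
    Function.Injective (DSigma θ).mulVec := by
  rw [← coe_mulVecLin, ← LinearMap.ker_eq_bot, LinearMap.ker_eq_bot']
  intro y hy
  set x : Param p₁ p₂ r := WithLp.toLp 2 y with hx
  rw [mulVecLin_apply, show y = x.ofLp from rfl, DSigma_mulVec, vec_eq_zero_iff] at hy
  set M := matM θ
  set A := matA θ
  set dM := matM x
  set dA := matA x
  set T := topEmbed p₂ r with hT
  set B := botProj p₂ r with hB
  -- The matrix (1 + X)(Bᵀ - TAᵀ) has columns orthogonal to those of U, so multiplying the kernel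
  -- equation by it on the right removes the dM term.
  have hU : (cayleyU A)ᵀ * (Bᵀ - T * Aᵀ + cayleyX A * (Bᵀ - T * Aᵀ)) = 0 := by
    have h1 : Bᵀ - T * Aᵀ + cayleyX A * (Bᵀ - T * Aᵀ) = (1 + cayleyX A) * (Bᵀ - T * Aᵀ) := by
      rw [Matrix.add_mul, Matrix.one_mul]
    have h2 : (cayleyU A)ᵀ = Tᵀ * (1 + cayleyX A)⁻¹ * (1 - cayleyX A) := by
      rw [cayleyU, transpose_mul, transpose_mul, transpose_nonsing_inv, transpose_sub,
        transpose_add, cayleyX_transpose, transpose_one, sub_neg_eq_add, ← sub_eq_add_neg,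
        ← Matrix.mul_assoc]
    have h3 : (1 - cayleyX A) * (1 + cayleyX A) = (1 + cayleyX A) * (1 - cayleyX A) := by
      noncomm_ring
    have hu : IsUnit (1 + cayleyX A).det := by
      have := isUnit_det_one_sub_cayleyX A
      rw [← det_transpose] at this
      simpa [cayleyX_transpose] using this
    have h4 : Tᵀ * (1 - cayleyX A) = Tᵀ + Aᵀ * B := by
      rw [← transpose_transpose (Tᵀ * (1 - cayleyX A)), transpose_mul, transpose_sub,
        cayleyX_transpose, transpose_one, sub_neg_eq_add, Matrix.add_mul, transpose_transpose,
        cayleyX_mul_topEmbed hr]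
      simp [hT, hB]
    rw [h1, h2, Matrix.mul_assoc, ← Matrix.mul_assoc (1 - cayleyX A), h3,
      Matrix.mul_assoc (1 + cayleyX A), Matrix.mul_assoc,
      nonsing_inv_mul_cancel_left _ _ hu, ← Matrix.mul_assoc, h4, Matrix.add_mul,
      Matrix.mul_sub, Matrix.mul_sub, topEmbed_transpose_mul_botProj_transpose,
      ← Matrix.mul_assoc, topEmbed_transpose_mul hr, Matrix.mul_assoc Aᵀ, botProj_mul_transpose,
      Matrix.mul_assoc Aᵀ B, ← Matrix.mul_assoc B, botProj_mul_topEmbed]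
    simp
  have hdU : (cayleyTangent A dA)ᵀ * (Bᵀ - T * Aᵀ + cayleyX A * (Bᵀ - T * Aᵀ)) =
      (2 : ℝ) • (cayleyH A * (dAᵀ + Aᵀ * dA * Aᵀ)) := by
    have h1 : Bᵀ - T * Aᵀ + cayleyX A * (Bᵀ - T * Aᵀ) = (1 - cayleyX A)ᵀ * (Bᵀ - T * Aᵀ) := by
      rw [transpose_sub, cayleyX_transpose, transpose_one, sub_neg_eq_add, Matrix.add_mul,
        Matrix.one_mul]
    have hu := isUnit_det_transpose _ (isUnit_det_one_sub_cayleyX A)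
    have h2 : (cayleyTangent A dA)ᵀ =
        (2 : ℝ) • ((cayleyH A)ᵀ * (cayleyF A)ᵀ * (cayleyX dA)ᵀ * ((1 - cayleyX A)ᵀ)⁻¹) := by
      rw [cayleyTangent, Matrix.mul_assoc, inv_mul_topEmbed hr, transpose_smul, transpose_mul,
        transpose_mul, transpose_mul, transpose_nonsing_inv]
      simp only [Matrix.mul_assoc]
    have h3 : (cayleyX dA)ᵀ * (Bᵀ - T * Aᵀ) = T * dAᵀ + Bᵀ * (dA * Aᵀ) := by
      rw [cayleyX_transpose, Matrix.neg_mul, Matrix.mul_sub, cayleyX_mul_botProj_transpose,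
        ← Matrix.mul_assoc, cayleyX_mul_topEmbed hr, Matrix.mul_assoc]
      abel
    have h4 : (cayleyF A)ᵀ * T = 1 := by
      rw [← transpose_transpose ((cayleyF A)ᵀ * T), transpose_mul, transpose_transpose,
        topEmbed_transpose_mul_cayleyF hr, transpose_one]
    have h5 : (cayleyF A)ᵀ * Bᵀ = Aᵀ := by
      rw [← transpose_mul, botProj_mul_cayleyF]
    rw [h1, h2, Matrix.smul_mul, Matrix.mul_assoc, nonsing_inv_mul_cancel_left _ _ hu,
      Matrix.mul_assoc, h3, Matrix.mul_assoc, Matrix.mul_add, ← Matrix.mul_assoc _ T, h4,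
      ← Matrix.mul_assoc _ Bᵀ, h5, Matrix.one_mul, cayleyH_transpose, ← Matrix.mul_assoc Aᵀ]
  have h1 : M * ((2 : ℝ) • (cayleyH A * (dAᵀ + Aᵀ * dA * Aᵀ))) = 0 := by
    have := congrArg (fun Y => Y * (Bᵀ - T * Aᵀ + cayleyX A * (Bᵀ - T * Aᵀ))) hy
    simpa only [Matrix.add_mul, Matrix.mul_assoc, hU, hdU, Matrix.mul_zero, zero_add,
      Matrix.zero_mul] using this
  -- Left-cancelling M and then H leaves the contraction equation, which has only the zero solution.
  have h2 : dAᵀ + Aᵀ * dA * Aᵀ = 0 := by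
    have := congrArg (fun Y => (1 + Aᵀ * A) * ((Mᵀ * M)⁻¹ * (Mᵀ * Y))) h1
    simp only [← Matrix.mul_assoc Mᵀ, nonsing_inv_mul_cancel_left _ _ hM, Matrix.mul_zero,
      Matrix.mul_smul, ← Matrix.mul_assoc (1 + Aᵀ * A), mul_cayleyH, Matrix.one_mul] at this
    exact (smul_eq_zero.mp this).resolve_left two_ne_zero
  have hdA : dA = 0 := eq_zero_of_eq_neg_mul_transpose_mul hA (eq_neg_of_add_eq_zero_left h2)
  have hdM : dM = 0 := by
    have h0 : cayleyTangent A 0 = 0 := by simp [cayleyTangent, cayleyX]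
    rw [hdA, h0, transpose_zero, Matrix.mul_zero, add_zero] at hy
    have := congrArg (fun Y => Y * cayleyU A) hy
    simpa only [Matrix.mul_assoc, cayleyU_transpose_mul_self hr, Matrix.mul_one,
      Matrix.zero_mul] using this
  ext k
  rcases k with ⟨j, i⟩ | ⟨j, i⟩
  · exact congrFun (congrFun hdA i) j
  · exact congrFun (congrFun hdM i) j

/-- The vectorization of a matrix as a vector in Euclidean space. -/
def vecE (S : Matrix (Fin p₁) (Fin p₂) ℝ) : EuclideanSpace ℝ (Fin p₂ × Fin p₁) :=
  WithLp.toLp 2 (vec S)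

@[simp] lemma vecE_apply (S : Matrix (Fin p₁) (Fin p₂) ℝ) (a : Fin p₂ × Fin p₁) :
    vecE S a = S a.2 a.1 := rfl

lemma vecE_sub (S S' : Matrix (Fin p₁) (Fin p₂) ℝ) : vecE (S - S') = vecE S - vecE S' := rfl

lemma vecE_add (S S' : Matrix (Fin p₁) (Fin p₂) ℝ) : vecE (S + S') = vecE S + vecE S' := rfl

lemma vecE_injective : Function.Injective (vecE : Matrix (Fin p₁) (Fin p₂) ℝ → _) := by
  intro S S' h
  ext i j
  exact congrArg (fun v : EuclideanSpace ℝ (Fin p₂ × Fin p₁) => v (j, i)) h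

lemma norm_vecE_sq (S : Matrix (Fin p₁) (Fin p₂) ℝ) : ‖vecE S‖ ^ 2 = frobSq S := by
  rw [EuclideanSpace.norm_sq_eq, frobSq, Fintype.sum_prod_type, Finset.sum_comm]
  simp

open scoped Matrix.Norms.L2Operator in
-- Writing U = 2(1 - X)⁻¹T - T reduces the claim to the derivative of ring inversion. That needs a
-- complete normed ring, supplied by the operator norm; stating the result entrywise keeps this
-- choice of norm out of later use.
lemma exists_hasFDerivAt_cayleyU_apply (θ : Param p₁ p₂ r) (t : Fin p₂) (k : Fin r) :
    ∃ D : Param p₁ p₂ r →L[ℝ] ℝ,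
      HasFDerivAt (fun θ' : Param p₁ p₂ r => cayleyU (matA θ') t k) D θ ∧
        ∀ x, D x = cayleyTangent (matA θ) (matA x) t k := by
  let X : Param p₁ p₂ r →L[ℝ] Matrix (Fin p₂) (Fin p₂) ℝ := LinearMap.toContinuousLinearMap
    { toFun := fun x => cayleyX (matA x)
      map_add' := fun x y => by
        have : matA (x + y) = matA x + matA y := rfl
        simp only [this, cayleyX, Matrix.mul_add, Matrix.add_mul, transpose_add]
        abel
      map_smul' := fun c x => by
        have : matA (c • x) = c • matA x := rfl
        simp only [this, cayleyX, Matrix.mul_smul, Matrix.smul_mul, transpose_smul, smul_sub,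
          RingHom.id_apply] }
  let ℓ : Matrix (Fin p₂) (Fin p₂) ℝ →L[ℝ] ℝ := LinearMap.toContinuousLinearMap
    { toFun := fun Z => (2 : ℝ) * (Z * topEmbed p₂ r) t k
      map_add' := fun Y Z => by simp only [Matrix.add_mul, Matrix.add_apply]; ring
      map_smul' := fun c Z => by
        simp only [Matrix.smul_mul, Matrix.smul_apply, smul_eq_mul, RingHom.id_apply]; ring }
  have hu : IsUnit (1 - cayleyX (matA θ)) :=
    (isUnit_iff_isUnit_det _).mpr (isUnit_det_one_sub_cayleyX (matA θ))
  have h1 : HasFDerivAt (fun θ' : Param p₁ p₂ r => 1 - X θ') (-X) θ := by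
    simpa using (X.hasFDerivAt (x := θ)).const_sub 1
  have h2 := hasFDerivAt_ringInverse (𝕜 := ℝ) hu.unit
  have h3 := ℓ.hasFDerivAt.comp θ (HasFDerivAt.comp θ h2 h1)
  refine ⟨_, (h3.sub_const (topEmbed p₂ r t k)).congr_of_eventuallyEq
    (Eventually.of_forall fun θ' => ?_), fun x => ?_⟩
  · have h4 : cayleyU (matA θ') t k =
        (2 : ℝ) * ((1 - cayleyX (matA θ'))⁻¹ * topEmbed p₂ r) t k - topEmbed p₂ r t k := by
      rw [cayleyU_eq_inv]; rfl
    rw [nonsing_inv_eq_ringInverse] at h4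
    exact h4
  · have h4 : (↑hu.unit⁻¹ : Matrix (Fin p₂) (Fin p₂) ℝ) = (1 - cayleyX (matA θ))⁻¹ := by
      rw [nonsing_inv_eq_ringInverse, ← Ring.inverse_unit, IsUnit.unit_spec]
    change (2 : ℝ) * (-((↑hu.unit⁻¹ : Matrix (Fin p₂) (Fin p₂) ℝ) * (-cayleyX (matA x)) *
      (↑hu.unit⁻¹ : Matrix (Fin p₂) (Fin p₂) ℝ)) * topEmbed p₂ r) t k = _
    have h5 : cayleyTangent (matA θ) (matA x) = (2 : ℝ) • (-((1 - cayleyX (matA θ))⁻¹ *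
        (-cayleyX (matA x)) * (1 - cayleyX (matA θ))⁻¹) * topEmbed p₂ r) := by
      rw [cayleyTangent, Matrix.mul_neg, Matrix.neg_mul, Matrix.neg_mul, Matrix.neg_mul, neg_neg]
    rw [h4, h5]
    rfl

/-- The linear map with matrix `DSigma θ`. -/
def DSigmaCLM (θ : Param p₁ p₂ r) :
    Param p₁ p₂ r →L[ℝ] EuclideanSpace ℝ (Fin p₂ × Fin p₁) :=
  (toLpLin 2 2 (DSigma θ)).toContinuousLinearMap

lemma DSigmaCLM_apply (θ x : Param p₁ p₂ r) :
    DSigmaCLM θ x =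
      vecE (matM x * (cayleyU (matA θ))ᵀ + matM θ * (cayleyTangent (matA θ) (matA x))ᵀ) := by
  rw [vecE, ← DSigma_mulVec]
  rfl

lemma hasFDerivAt_vecE_sigmaMap (θ : Param p₁ p₂ r) :
    HasFDerivAt (fun θ' : Param p₁ p₂ r => vecE (sigmaMap θ')) (DSigmaCLM θ) θ := by
  rw [← hasFDerivWithinAt_univ, hasFDerivWithinAt_euclidean]
  rintro ⟨t, s⟩
  choose D hD hDx using fun k => exists_hasFDerivAt_cayleyU_apply θ t k
  have hM : ∀ k, HasFDerivAt (fun θ' : Param p₁ p₂ r => θ' (Sum.inr (k, s)))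
      (EuclideanSpace.proj (Sum.inr (k, s)) : Param p₁ p₂ r →L[ℝ] ℝ) θ := fun k =>
    (EuclideanSpace.proj (Sum.inr (k, s)) : Param p₁ p₂ r →L[ℝ] ℝ).hasFDerivAt
  have h := HasFDerivAt.fun_sum (u := Finset.univ) fun k _ => (hM k).mul (hD k)
  rw [hasFDerivWithinAt_univ]
  refine h.congr_fderiv ?_
  ext x
  rw [ContinuousLinearMap.comp_apply, DSigmaCLM_apply]
  simp [hDx, mul_apply, Finset.sum_add_distrib, matM, mul_comm, add_comm]

lemma continuous_vecE_sigmaMap :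
    Continuous fun θ : Param p₁ p₂ r => vecE (sigmaMap θ) :=
  continuous_iff_continuousAt.mpr fun θ => (hasFDerivAt_vecE_sigmaMap θ).continuousAt

lemma continuous_matA : Continuous (matA : Param p₁ p₂ r → _) :=
  continuous_pi fun i => continuous_pi fun j => by
    change Continuous fun θ : Param p₁ p₂ r => θ (Sum.inl (j, i))
    fun_prop

lemma isOpen_paramSpace : IsOpen (paramSpace p₁ p₂ r) :=
  isOpen_lt (continuous_specNorm.comp continuous_matA) continuous_const

open scoped Matrix.Norms.L2Operator in
/-- The parameters with `‖A‖₂ ≤ 1` and bounded `Σ(θ)` form a compact set. -/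
lemma isCompact_specNorm_le_one (hr : r ≤ p₂) (R : ℝ) :
    IsCompact {θ : Param p₁ p₂ r | specNorm (matA θ) ≤ 1 ∧ ‖vecE (sigmaMap θ)‖ ≤ R} := by
  refine Metric.isCompact_of_isClosed_isBounded ?_ ?_
  · exact (isClosed_le (continuous_specNorm.comp continuous_matA) continuous_const).inter
      (isClosed_le continuous_vecE_sigmaMap.norm continuous_const)
  · have hentry : ∀ {m n : ℕ} (Z : Matrix (Fin m) (Fin n) ℝ) (i : Fin m) (j : Fin n),
        |Z i j| ≤ specNorm Z := by
      intro m n Z i j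
      have h := norm_toLp_mulVec_le Z (Pi.single j 1)
      have h2 := PiLp.norm_apply_le (WithLp.toLp 2 (Z *ᵥ Pi.single j 1)) i
      have h3 : ‖(WithLp.toLp 2 (Pi.single j (1 : ℝ)) : EuclideanSpace ℝ (Fin n))‖ = 1 := by
        simp
      rw [h3, mul_one] at h
      have h4 := h2.trans h
      simp only [mulVec_single_one, Real.norm_eq_abs] at h4
      exact h4
    rw [isBounded_iff_forall_norm_le]
    refine ⟨(Fintype.card (ParamIdx p₁ p₂ r) : ℝ) * (1 + Fintype.card (Fin p₂) * R),
      fun θ hθ => ?_⟩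
    have hR : 0 ≤ R := (norm_nonneg _).trans hθ.2
    have hU : specNorm (cayleyU (matA θ)) ≤ 1 := by
      have := specNorm_transpose_mul_self (cayleyU (matA θ))
      rw [cayleyU_transpose_mul_self hr] at this
      have h1 : ‖(1 : Matrix (Fin r) (Fin r) ℝ)‖ ≤ 1 := by
        rw [← diagonal_one, l2_opNorm_diagonal]
        exact (pi_norm_le_iff_of_nonneg zero_le_one).mpr fun i => by simp
      rw [this] at h1
      exact (sq_le_one_iff₀ (specNorm_nonneg _)).mp h1
    have hcoord : ∀ k, |θ k| ≤ 1 + Fintype.card (Fin p₂) * R := by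
      rintro (⟨j, i⟩ | ⟨j, i⟩)
      · have h1 := (hentry (matA θ) i j).trans hθ.1
        have : 0 ≤ Fintype.card (Fin p₂) * R := by positivity
        exact h1.trans (by linarith)
      -- Orthonormality of U recovers M from Σ(θ), so a bound on Σ(θ) bounds M.
      · have h1 : matM θ = sigmaMap θ * cayleyU (matA θ) := by
          rw [sigmaMap, Matrix.mul_assoc, cayleyU_transpose_mul_self hr, Matrix.mul_one]
        have h2 : θ (Sum.inr (j, i)) = ∑ t, sigmaMap θ i t * cayleyU (matA θ) t j := by
          rw [← mul_apply, ← h1]; rfl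
        rw [h2]
        refine (Finset.abs_sum_le_sum_abs _ _).trans ?_
        have h3 : ∀ t ∈ Finset.univ, |sigmaMap θ i t * cayleyU (matA θ) t j| ≤ R := by
          intro t _
          rw [abs_mul]
          have h4 : |sigmaMap θ i t| ≤ R :=
            (PiLp.norm_apply_le (vecE (sigmaMap θ)) (t, i)).trans hθ.2
          have h5 := (hentry (cayleyU (matA θ)) t j).trans hU
          have := abs_nonneg (cayleyU (matA θ) t j)
          nlinarith
        have := Finset.sum_le_card_nsmul _ _ _ h3
        rw [nsmul_eq_mul] at this
        exact this.trans (by simp)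
    have h1 : ‖θ‖ ≤ ∑ k, ‖θ k‖ := by
      conv_lhs => rw [← (EuclideanSpace.basisFun (ParamIdx p₁ p₂ r) ℝ).sum_repr θ]
      refine (norm_sum_le _ _).trans (Finset.sum_le_sum fun k _ => ?_)
      rw [norm_smul]
      simp
    refine h1.trans ((Finset.sum_le_card_nsmul _ _ _ fun k _ => hcoord k).trans ?_)
    rw [nsmul_eq_mul]; rfl

/-- If `θ₀` has full rank, `Σ(θ) → Σ(θ₀)` within the parameter space forces `θ → θ₀`. -/
lemma comap_vecE_sigmaMap_inf_le (hr : r ≤ p₂) {θ₀ : Param p₁ p₂ r}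
    (hM : IsUnit ((matM θ₀)ᵀ * matM θ₀).det) (hA : specNorm (matA θ₀) < 1) :
    comap (fun θ : Param p₁ p₂ r => vecE (sigmaMap θ)) (𝓝 (vecE (sigmaMap θ₀))) ⊓
      𝓟 (paramSpace p₁ p₂ r) ≤ 𝓝 θ₀ := by
  intro V hV
  obtain ⟨V', hV'V, hV'o, hθ₀⟩ := mem_nhds_iff.mp hV
  set f := fun θ : Param p₁ p₂ r => vecE (sigmaMap θ) with hf
  set R := ‖f θ₀‖ + 1
  set C := {θ : Param p₁ p₂ r | specNorm (matA θ) ≤ 1 ∧ ‖f θ‖ ≤ R}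
  -- The set C contains the boundary ‖A‖ = 1, as compactness requires. Identifiability against such
  -- A keeps f θ₀ outside this compact image, hence at positive distance from it.
  have hK : IsCompact (f '' (C \ V')) :=
    ((isCompact_specNorm_le_one hr R).diff hV'o).image continuous_vecE_sigmaMap
  have hnot : f θ₀ ∉ f '' (C \ V') := by
    rintro ⟨θ, ⟨hθC, hθV⟩, hθ⟩
    have h1 := eq_and_eq_of_mul_cayleyU_transpose_eq hr hM hA hθC.1 (vecE_injective hθ)
    refine hθV ?_
    have : θ = θ₀ := by
      ext k
      rcases k with ⟨j, i⟩ | ⟨j, i⟩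
      · exact congrFun (congrFun h1.1 i) j
      · exact congrFun (congrFun h1.2 i) j
    rwa [this]
  have hn1 : (f '' (C \ V'))ᶜ ∈ 𝓝 (f θ₀) := hK.isClosed.isOpen_compl.mem_nhds hnot
  have hn2 : {y | ‖y‖ < R} ∈ 𝓝 (f θ₀) :=
    (isOpen_lt continuous_norm continuous_const).mem_nhds (by simp [R])
  refine mem_of_superset (inter_mem_inf (preimage_mem_comap (inter_mem hn1 hn2))
    (mem_principal_self _)) ?_
  rintro θ ⟨⟨h1, h2⟩, h3⟩
  by_contra hθ
  exact h1 ⟨θ, ⟨⟨le_of_lt h3, le_of_lt h2⟩, fun h => hθ (hV'V h)⟩, rfl⟩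

end Derivative

/-! ### Nonlinear least squares -/

section LeastSquares

variable {E F : Type*} [NormedAddCommGroup E] [InnerProductSpace ℝ E]
  [NormedAddCommGroup F] [InnerProductSpace ℝ F]

/-- Linearization of nonlinear least squares at a point where the parameterization `f` has an
injective derivative `D` and is locally identifiable: if `D ∘ L` is the orthogonal projection on
the range of `D`, the least-squares estimator is `θ₀ + L (y - f θ₀)` up to an error which is
small compared to `y - f θ₀`. -/
lemma eventually_norm_leastSquares_sub_le {Θ : Set E} {f : E → F} {θ₀ : E} {D : E →L[ℝ] F}
    (hΘ : Θ ∈ 𝓝 θ₀) (hf : HasFDerivAt f D θ₀) {c : ℝ} (hc : 0 < c) (hD : ∀ h, c * ‖h‖ ≤ ‖D h‖)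
    {L : F →L[ℝ] E} (hL : ∀ z h, inner ℝ (z - D (L z)) (D h) = 0)
    (hinv : comap f (𝓝 (f θ₀)) ⊓ 𝓟 Θ ≤ 𝓝 θ₀) {ε : ℝ} (hε : 0 < ε) :
    ∀ᶠ y in 𝓝 (f θ₀), ∀ θ ∈ Θ, IsMinOn (fun θ' => ‖y - f θ'‖) Θ θ →
      ‖θ - θ₀ - L (y - f θ₀)‖ ≤ ε * ‖y - f θ₀‖ := by
  -- The term 4/c controls the actual increment h of the minimizer and ‖L‖ the linearized one h₀,
  -- both relative to ‖z‖.
  set C := 4 / c + ‖L‖ with hC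
  have hC0 : 0 < C := by positivity
  -- The bound c/2 absorbs the Taylor remainder into the lower bound on D, the bound 1 gives η² ≤ η,
  -- and the last one turns the final error into ε.
  obtain ⟨η, hη0, hηc, hη1, hη2⟩ : ∃ η : ℝ, 0 < η ∧ η ≤ c / 2 ∧ η ≤ 1 ∧
      η * (2 * C + C ^ 2) ≤ c ^ 2 * ε ^ 2 := by
    refine ⟨min (c / 2) (min 1 (c ^ 2 * ε ^ 2 / (2 * C + C ^ 2))), by positivity,
      min_le_left _ _, (min_le_right _ _).trans (min_le_left _ _), ?_⟩
    rw [← le_div_iff₀ (by positivity)]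
    exact (min_le_right _ _).trans (min_le_right _ _)
  have happrox : ∀ᶠ θ in 𝓝 θ₀, ‖f θ - f θ₀ - D (θ - θ₀)‖ ≤ η * ‖θ - θ₀‖ :=
    hf.isLittleO.def hη0
  -- A θ fitting at least as well as θ₀ has f θ near f θ₀, so by `hinv` it lies where the Taylor
  -- estimate holds.
  have hev1 : ∀ᶠ y in 𝓝 (f θ₀), ∀ θ ∈ Θ, ‖y - f θ‖ ≤ ‖y - f θ₀‖ →
      ‖f θ - f θ₀ - D (θ - θ₀)‖ ≤ η * ‖θ - θ₀‖ := by
    obtain ⟨s, hs, t, ht, hst⟩ := mem_inf_iff.mp (hinv happrox)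
    obtain ⟨U, hU, hUs⟩ := mem_comap.mp hs
    obtain ⟨ρ, hρ, hball⟩ := Metric.mem_nhds_iff.mp hU
    filter_upwards [Metric.ball_mem_nhds (f θ₀) (half_pos hρ)] with y hy θ hθ hle
    have : θ ∈ s ∩ t := by
      refine ⟨hUs (hball ?_), mem_principal.mp ht hθ⟩
      rw [Metric.mem_ball, dist_eq_norm] at hy ⊢
      calc ‖f θ - f θ₀‖ = ‖(y - f θ₀) - (y - f θ)‖ := by congr 1; abel
        _ ≤ ‖y - f θ₀‖ + ‖y - f θ‖ := norm_sub_le _ _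
        _ < ρ := by linarith
    rw [← hst] at this
    exact this
  have hev2 : ∀ᶠ y in 𝓝 (f θ₀), θ₀ + L (y - f θ₀) ∈ Θ ∧
      ‖f (θ₀ + L (y - f θ₀)) - f θ₀ - D (L (y - f θ₀))‖ ≤ η * ‖L (y - f θ₀)‖ := by
    have hcont : Tendsto (fun y => θ₀ + L (y - f θ₀)) (𝓝 (f θ₀)) (𝓝 θ₀) := by
      have : Continuous fun y => θ₀ + L (y - f θ₀) := by fun_prop
      simpa using this.tendsto (f θ₀)
    filter_upwards [hcont.eventually hΘ, hcont.eventually happrox] with y h1 h2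
    simp only [add_sub_cancel_left] at h2
    exact ⟨h1, h2⟩
  filter_upwards [hev1, hev2] with y h1 h2 θ hθ hmin
  set z := y - f θ₀ with hz
  set h := θ - θ₀ with hh
  set h₀ := L z with hh₀
  have hle : ‖y - f θ‖ ≤ ‖z‖ := hmin (mem_of_mem_nhds hΘ)
  have hr := h1 θ hθ hle
  have hfθ : ‖f θ - f θ₀‖ ≤ 2 * ‖z‖ := by
    calc ‖f θ - f θ₀‖ = ‖z - (y - f θ)‖ := by congr 1; rw [hz]; abel
      _ ≤ ‖z‖ + ‖y - f θ‖ := norm_sub_le _ _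
      _ ≤ 2 * ‖z‖ := by linarith
  have hnh : ‖h‖ ≤ 4 / c * ‖z‖ := by
    have h3 : ‖D h‖ ≤ ‖f θ - f θ₀‖ + ‖f θ - f θ₀ - D h‖ := by
      calc ‖D h‖ = ‖(f θ - f θ₀) - (f θ - f θ₀ - D h)‖ := by congr 1; abel
        _ ≤ _ := norm_sub_le _ _
    have h4 : η * ‖h‖ ≤ c / 2 * ‖h‖ := by gcongr
    have h5 : c * ‖h‖ ≤ 4 * ‖z‖ := by linarith [hD h]
    rw [div_mul_eq_mul_div, le_div_iff₀ hc]
    linarith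
  have hnh₀ : ‖h₀‖ ≤ ‖L‖ * ‖z‖ := L.le_opNorm z
  -- Pythagoras: the residual z - D h₀ is orthogonal to the range of D.
  have horth : ∀ k, ‖z - D h₀ - D k‖ ^ 2 = ‖z - D h₀‖ ^ 2 + ‖D k‖ ^ 2 := fun k => by
    rw [norm_sub_sq_real, hL]; ring
  have hproj : ‖z - D h₀‖ ≤ ‖z‖ := by
    have := horth (-h₀)
    simp only [map_neg, sub_neg_eq_add, sub_add_cancel, norm_neg] at this
    exact abs_le_of_sq_le_sq' (by nlinarith [sq_nonneg ‖D h₀‖]) (norm_nonneg _) |>.2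
  -- The minimizer is compared with the competitor θ₀ + h₀; replacing f by its linearization at both
  -- points costs ηC‖z‖ in total.
  have hmain : ‖z - D h‖ ≤ ‖z - D h₀‖ + η * (C * ‖z‖) := by
    have e1 : ‖z - D h‖ ≤ ‖y - f θ‖ + η * ‖h‖ := by
      calc ‖z - D h‖ = ‖(y - f θ) + (f θ - f θ₀ - D h)‖ := by congr 1; rw [hz]; abel
        _ ≤ _ := (norm_add_le _ _).trans (by gcongr)
    have e2 : ‖y - f (θ₀ + h₀)‖ ≤ ‖z - D h₀‖ + η * ‖h₀‖ := by
      calc ‖y - f (θ₀ + h₀)‖ = ‖(z - D h₀) - (f (θ₀ + h₀) - f θ₀ - D h₀)‖ := by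
            congr 1; rw [hz]; abel
        _ ≤ _ := (norm_sub_le _ _).trans (by gcongr; exact h2.2)
    have e3 : ‖y - f θ‖ ≤ ‖y - f (θ₀ + h₀)‖ := hmin h2.1
    have e4 : η * ‖h‖ + η * ‖h₀‖ ≤ η * (C * ‖z‖) := by
      rw [← mul_add]
      gcongr
      rw [hC, add_mul]
      linarith
    linarith
  have hdiff : z - D h = z - D h₀ - D (h - h₀) := by
    rw [map_sub D h h₀]; abel
  -- By Pythagoras the left side is the excess of the squared linear residual at h over its minimum
  -- at h₀.
  have hsq : ‖D (h - h₀)‖ ^ 2 ≤ η * (2 * C + C ^ 2) * ‖z‖ ^ 2 := by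
    have e1 := horth (h - h₀)
    rw [← hdiff] at e1
    have hz0 := norm_nonneg z
    have e2 : ‖z - D h‖ ^ 2 ≤ (‖z - D h₀‖ + η * (C * ‖z‖)) ^ 2 := by gcongr
    have e3 : ‖z - D h₀‖ * (η * (C * ‖z‖)) ≤ ‖z‖ * (η * (C * ‖z‖)) := by gcongr
    have e4 : η ^ 2 * (C * ‖z‖) ^ 2 ≤ η * (C * ‖z‖) ^ 2 := by
      gcongr
      nlinarith
    nlinarith
  have hfin : (c * ‖h - h₀‖) ^ 2 ≤ (c * (ε * ‖z‖)) ^ 2 := by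
    calc (c * ‖h - h₀‖) ^ 2 ≤ ‖D (h - h₀)‖ ^ 2 := by gcongr; exact hD _
      _ ≤ η * (2 * C + C ^ 2) * ‖z‖ ^ 2 := hsq
      _ ≤ c ^ 2 * ε ^ 2 * ‖z‖ ^ 2 := by gcongr
      _ = _ := by ring
  have := abs_le_of_sq_le_sq' hfin (by positivity) |>.2
  exact le_of_mul_le_mul_left this hc

/-- Near an identifiable point, a least-squares estimator exists. -/
lemma eventually_exists_leastSquares {E F : Type*} [NormedAddCommGroup E] [NormedSpace ℝ E]
    [FiniteDimensional ℝ E] [NormedAddCommGroup F] {Θ : Set E} {f : E → F} {θ₀ : E}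
    (hΘ : Θ ∈ 𝓝 θ₀) (hf : Continuous f) (hinv : comap f (𝓝 (f θ₀)) ⊓ 𝓟 Θ ≤ 𝓝 θ₀) :
    ∀ᶠ y in 𝓝 (f θ₀), ∃ θ ∈ Θ, IsMinOn (fun θ' => ‖y - f θ'‖) Θ θ := by
  obtain ⟨ρ, hρ, hball⟩ := Metric.nhds_basis_closedBall.mem_iff.mp hΘ
  obtain ⟨s, hs, t, ht, hst⟩ := mem_inf_iff.mp (hinv (Metric.closedBall_mem_nhds θ₀ hρ))
  obtain ⟨U, hU, hUs⟩ := mem_comap.mp hs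
  obtain ⟨δ, hδ, hballU⟩ := Metric.mem_nhds_iff.mp hU
  filter_upwards [Metric.ball_mem_nhds (f θ₀) (half_pos hδ)] with y hy
  have : ProperSpace E := FiniteDimensional.proper ℝ E
  obtain ⟨θ, hθ, hmin⟩ := (isCompact_closedBall θ₀ ρ).exists_isMinOn
    ⟨θ₀, Metric.mem_closedBall_self hρ.le⟩ (f := fun θ' => ‖y - f θ'‖) (by fun_prop)
  refine ⟨θ, hball hθ, fun θ' hθ' => ?_⟩
  by_cases hb : θ' ∈ Metric.closedBall θ₀ ρ
  · exact hmin hb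
  -- Outside the ball f θ' is at least δ away from f θ₀, while y is within δ/2, so θ' fits worse
  -- than θ₀ and cannot beat the minimizer on the ball.
  · have h1 : ‖y - f θ‖ ≤ ‖y - f θ₀‖ := hmin (Metric.mem_closedBall_self hρ.le)
    have h2 : δ ≤ ‖f θ' - f θ₀‖ := by
      by_contra hlt
      refine hb ?_
      rw [hst]
      refine ⟨hUs (hballU ?_), mem_principal.mp ht hθ'⟩
      rw [Metric.mem_ball, dist_eq_norm]
      exact not_le.mp hlt
    have h3 : ‖f θ' - f θ₀‖ ≤ ‖y - f θ₀‖ + ‖y - f θ'‖ := by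
      calc ‖f θ' - f θ₀‖ = ‖(y - f θ₀) - (y - f θ')‖ := by congr 1; abel
        _ ≤ _ := norm_sub_le _ _
    rw [Metric.mem_ball, dist_eq_norm] at hy
    change ‖y - f θ‖ ≤ ‖y - f θ'‖
    linarith

end LeastSquares

/-! ### Characteristic functions of weighted sums -/

section CharFun

/-- Replace the factors one at a time; the remaining ones have modulus at most one. -/
lemma norm_prod_sub_prod_le {ι : Type*} (s : Finset ι) (z w : ι → ℂ) (hz : ∀ k, ‖z k‖ ≤ 1)
    (hw : ∀ k, ‖w k‖ ≤ 1) : ‖∏ k ∈ s, z k - ∏ k ∈ s, w k‖ ≤ ∑ k ∈ s, ‖z k - w k‖ := by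
  classical
  induction s using Finset.induction_on with
  | empty => simp
  | insert a s ha ih =>
    rw [Finset.prod_insert ha, Finset.prod_insert ha, Finset.sum_insert ha]
    have h1 : ‖∏ k ∈ s, w k‖ ≤ 1 := by
      rw [norm_prod]
      exact Finset.prod_le_one (fun _ _ => norm_nonneg _) fun k _ => hw k
    calc ‖z a * ∏ k ∈ s, z k - w a * ∏ k ∈ s, w k‖
        = ‖z a * (∏ k ∈ s, z k - ∏ k ∈ s, w k) + (z a - w a) * ∏ k ∈ s, w k‖ := by
          congr 1; ring
      _ ≤ ‖z a‖ * ‖∏ k ∈ s, z k - ∏ k ∈ s, w k‖ + ‖z a - w a‖ * ‖∏ k ∈ s, w k‖ := by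
          refine (norm_add_le _ _).trans ?_
          rw [norm_mul, norm_mul]
      _ ≤ 1 * (∑ k ∈ s, ‖z k - w k‖) + ‖z a - w a‖ * 1 := by
          gcongr
          exact hz a
      _ = _ := by ring

/-- The fourth-order bound serves for |x| ≤ 1; beyond that 1 - x²/2 ≤ cos x ≤ 1 is enough. The
constant leaves room for the sine remainder, so that the combined bound has constant one. -/
lemma abs_cos_sub_le (x : ℝ) : |Real.cos x - (1 - x ^ 2 / 2)| ≤ 5 / 6 * |x| ^ 3 := by
  rcases le_total |x| 1 with h | h
  · refine (Real.cos_bound h).trans ?_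
    have := abs_nonneg x
    have h3 : |x| ^ 4 ≤ |x| ^ 3 := pow_le_pow_of_le_one this h (by norm_num)
    have : 0 ≤ |x| ^ 3 := by positivity
    linarith
  · rw [abs_of_nonneg (by linarith [Real.one_sub_sq_div_two_le_cos (x := x)])]
    have h1 := Real.cos_le_one x
    have h2 : |x| ^ 2 ≤ |x| ^ 3 := pow_le_pow_right₀ h (by norm_num)
    rw [sq_abs] at h2
    have : 0 ≤ |x| ^ 3 := by positivity
    linarith

lemma norm_cexp_sub_taylor_le (x : ℝ) :
    ‖Complex.exp (x * Complex.I) - (1 + x * Complex.I - (x : ℂ) ^ 2 / 2)‖ ≤ |x| ^ 3 := by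
  have h : Complex.exp (x * Complex.I) - (1 + x * Complex.I - (x : ℂ) ^ 2 / 2) =
      ((Real.cos x - (1 - x ^ 2 / 2) : ℝ) : ℂ) + ((Real.sin x - x : ℝ) : ℂ) * Complex.I := by
    rw [Complex.exp_mul_I]
    push_cast
    ring
  rw [h]
  refine (norm_add_le _ _).trans ?_
  rw [norm_mul, Complex.norm_I, mul_one, Complex.norm_real, Complex.norm_real, Real.norm_eq_abs,
    Real.norm_eq_abs]
  have h1 := abs_cos_sub_le x
  have h2 := Real.abs_sub_sin_le x
  rw [abs_sub_comm] at h2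
  linarith

lemma abs_exp_neg_sub_le {y : ℝ} (hy : 0 ≤ y) : |Real.exp (-y) - (1 - y)| ≤ y ^ 2 := by
  rcases le_total y 1 with h | h
  · have := Real.abs_exp_sub_one_sub_id_le (x := -y) (by rwa [abs_neg, abs_of_nonneg hy])
    rw [neg_sq] at this
    convert this using 2
    ring
  · have h1 := Real.add_one_le_exp (-y)
    have h2 : Real.exp (-y) ≤ 1 := Real.exp_le_one_iff.mpr (by linarith)
    rw [abs_of_nonneg (by linarith)]
    nlinarith

variable {Ω : Type*} [MeasurableSpace Ω] {P : Measure Ω} [IsProbabilityMeasure P]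

/-- Integrate the second-order expansion of exp(iaX); the linear term vanishes because X is centred.
-/
lemma norm_integral_cexp_sub_le {X : Ω → ℝ} (hX3 : MemLp X 3 P) (h0 : ∫ x, X x ∂P = 0) (a : ℝ) :
    ‖∫ x, Complex.exp ((a * X x : ℝ) * Complex.I) ∂P -
      ((1 - (∫ x, X x ^ 2 ∂P) * a ^ 2 / 2 : ℝ) : ℂ)‖ ≤ (∫ x, |X x| ^ 3 ∂P) * |a| ^ 3 := by
  have hXm := hX3.aestronglyMeasurable
  have i1 : Integrable X P := hX3.integrable (by norm_num)
  have i2 : Integrable (fun x => X x ^ 2) P :=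
    (hX3.mono_exponent (by norm_num : (2 : ENNReal) ≤ 3)).integrable_sq
  have i3 : Integrable (fun x => |X x| ^ 3) P := by
    simpa using hX3.integrable_norm_pow (p := 3) (by norm_num)
  have ie : Integrable (fun x => Complex.exp ((a * X x : ℝ) * Complex.I)) P := by
    refine Integrable.of_bound (C := 1) ?_ (ae_of_all _ fun x => ?_)
    · exact (by fun_prop : Continuous fun u : ℝ =>
        Complex.exp ((a * u : ℝ) * Complex.I)).comp_aestronglyMeasurable hXm
    · rw [Complex.norm_exp_ofReal_mul_I]
  have i1' : Integrable (fun x => ((X x : ℝ) : ℂ)) P := i1.ofReal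
  have i2' : Integrable (fun x => ((X x ^ 2 : ℝ) : ℂ)) P := i2.ofReal
  have it1 : Integrable (fun x => (1 : ℂ) + a * Complex.I * ((X x : ℝ) : ℂ)) P :=
    (integrable_const _).add (i1'.const_mul _)
  have it : Integrable (fun x => (1 : ℂ) + a * Complex.I * ((X x : ℝ) : ℂ) -
      (a : ℂ) ^ 2 / 2 * ((X x ^ 2 : ℝ) : ℂ)) P :=
    it1.sub (i2'.const_mul _)
  have ht : ((1 - (∫ x, X x ^ 2 ∂P) * a ^ 2 / 2 : ℝ) : ℂ) =
      ∫ x, ((1 : ℂ) + a * Complex.I * ((X x : ℝ) : ℂ) -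
        (a : ℂ) ^ 2 / 2 * ((X x ^ 2 : ℝ) : ℂ)) ∂P := by
    rw [integral_sub it1 (i2'.const_mul _),
      integral_add (integrable_const _) (i1'.const_mul _), integral_const_mul, integral_const_mul,
      integral_complex_ofReal, integral_complex_ofReal, h0]
    simp
    ring
  rw [ht, ← integral_sub ie it, ← integral_mul_const]
  refine norm_integral_le_of_norm_le (i3.mul_const _) (ae_of_all _ fun x => ?_)
  have := norm_cexp_sub_taylor_le (a * X x)
  rw [abs_mul, mul_pow, mul_comm (|a| ^ 3)] at this
  refine (le_of_eq (congrArg norm ?_)).trans this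
  push_cast
  ring

/-- A quantitative central limit theorem for weighted sums of independent random variables with
common variance, on the level of characteristic functions. -/
lemma norm_integral_cexp_sum_sub_le {ι : Type*} [Fintype ι] {X : ι → Ω → ℝ}
    (hX : iIndepFun X P) (hX3 : ∀ k, MemLp (X k) 3 P) (h0 : ∀ k, ∫ x, X k x ∂P = 0) {v B : ℝ}
    (hv0 : 0 ≤ v) (hv : ∀ k, ∫ x, X k x ^ 2 ∂P = v) (hB : ∀ k, ∫ x, |X k x| ^ 3 ∂P ≤ B)
    (a : ι → ℝ) :
    ‖∫ x, Complex.exp ((∑ k, a k * X k x : ℝ) * Complex.I) ∂P -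
      ((Real.exp (-(v * ∑ k, a k ^ 2) / 2) : ℝ) : ℂ)‖ ≤
        ∑ k, (B * |a k| ^ 3 + v ^ 2 * a k ^ 4) := by
  have hm : ∀ k, AEMeasurable (fun x => a k * X k x) P := fun k =>
    (hX3 k).aestronglyMeasurable.aemeasurable.const_mul _
  have hind : iIndepFun (fun k x => a k * X k x) P :=
    hX.comp (fun k u => a k * u) fun k => measurable_const_mul (a k)
  have hchar : ∀ {Z : Ω → ℝ}, AEMeasurable Z P →
      charFun (P.map Z) 1 = ∫ x, Complex.exp ((Z x : ℝ) * Complex.I) ∂P := by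
    intro Z hZ
    rw [charFun_apply_real, integral_map hZ]
    · simp
    · exact (by fun_prop : Continuous fun u : ℝ =>
        Complex.exp ((1 : ℝ) * u * Complex.I)).aestronglyMeasurable
  have hprod : ∫ x, Complex.exp ((∑ k, a k * X k x : ℝ) * Complex.I) ∂P =
      ∏ k, ∫ x, Complex.exp ((a k * X k x : ℝ) * Complex.I) ∂P := by
    rw [← hchar (Finset.aemeasurable_fun_sum _ fun k _ => hm k),
      hind.charFun_map_fun_sum_eq_prod hm, Finset.prod_apply]
    exact Finset.prod_congr rfl fun k _ => hchar (hm k)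
  have hexp : ((Real.exp (-(v * ∑ k, a k ^ 2) / 2) : ℝ) : ℂ) =
      ∏ k, ((Real.exp (-(v * a k ^ 2 / 2)) : ℝ) : ℂ) := by
    rw [← Complex.ofReal_prod, ← Real.exp_sum, Finset.sum_neg_distrib, ← Finset.sum_div,
      ← Finset.mul_sum, neg_div]
  rw [hprod, hexp]
  refine (norm_prod_sub_prod_le _ _ _ (fun k => ?_) fun k => ?_).trans
    (Finset.sum_le_sum fun k _ => ?_)
  · refine (norm_integral_le_of_norm_le_const (C := 1) (ae_of_all _ fun x => ?_)).trans (by simp)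
    rw [Complex.norm_exp_ofReal_mul_I]
  · rw [Complex.norm_real, Real.norm_eq_abs, abs_of_pos (Real.exp_pos _), Real.exp_le_one_iff]
    have : 0 ≤ v * a k ^ 2 := by positivity
    linarith
  · have h1 := norm_integral_cexp_sub_le (hX3 k) (h0 k) (a k)
    rw [hv k] at h1
    have h2 := abs_exp_neg_sub_le (y := v * a k ^ 2 / 2) (by positivity)
    have h3 : (∫ x, |X k x| ^ 3 ∂P) * |a k| ^ 3 ≤ B * |a k| ^ 3 := by
      gcongr
      exact hB k
    rw [abs_sub_comm, ← Real.norm_eq_abs, ← Complex.norm_real, Complex.ofReal_sub] at h2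
    have h4 : (v * a k ^ 2 / 2) ^ 2 ≤ v ^ 2 * a k ^ 4 := by
      have : 0 ≤ v ^ 2 * a k ^ 4 := by positivity
      nlinarith
    refine (norm_sub_le_norm_sub_add_norm_sub _ _ _).trans (add_le_add (h1.trans h3) (h2.trans h4))

/-- Use |x|³ ≤ 3! e^{|x|} ≤ 6(eˣ + e⁻ˣ) and the moment generating function at ±1. The bound depends
on K only, hence is uniform in m and n. -/
lemma integral_abs_pow_three_le {Ω : Type*} [MeasurableSpace Ω] {P : Measure Ω} {X : Ω → ℝ}
    {K : ℝ≥0} (hX : HasSubgaussianMGF X K P) :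
    ∫ x, |X x| ^ 3 ∂P ≤ 12 * Real.exp (K / 2) := by
  have i1 := hX.integrable_exp_mul 1
  have i2 := hX.integrable_exp_mul (-1)
  have m1 := hX.mgf_le 1
  have m2 := hX.mgf_le (-1)
  simp only [mgf] at m1 m2
  have i3 : Integrable (fun x => |X x| ^ 3) P := by
    simpa using (hX.memLp 3).integrable_norm_pow (p := 3) (by norm_num)
  calc ∫ x, |X x| ^ 3 ∂P ≤ ∫ x, 6 * (Real.exp (1 * X x) + Real.exp (-1 * X x)) ∂P := by
        refine integral_mono i3 ((i1.add i2).const_mul 6) fun x => ?_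
        have h1 := Real.pow_div_factorial_le_exp |X x| (abs_nonneg _) 3
        have h2 : Real.exp |X x| ≤ Real.exp (1 * X x) + Real.exp (-1 * X x) := by
          have p1 := Real.exp_pos (1 * X x)
          have p2 := Real.exp_pos (-1 * X x)
          rcases abs_choice (X x) with h | h <;> rw [h]
          · rw [one_mul] at *; linarith
          · rw [neg_one_mul] at *; linarith
        rw [div_le_iff₀ (by positivity)] at h1
        norm_num [Nat.factorial] at h1 h2 ⊢
        linarith
    _ = 6 * (∫ x, Real.exp (1 * X x) ∂P + ∫ x, Real.exp (-1 * X x) ∂P) := by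
        rw [integral_const_mul, integral_add i1 i2]
    _ ≤ _ := by norm_num at m1 m2 ⊢; linarith

/-- The second moment of a weighted sum of independent centred random variables. -/
lemma integral_sq_sum {ι : Type*} [Fintype ι] {X : ι → Ω → ℝ}
    (hX : iIndepFun X P) (hX2 : ∀ k, MemLp (X k) 2 P) (h0 : ∀ k, ∫ x, X k x ∂P = 0) {v : ℝ}
    (hv : ∀ k, ∫ x, X k x ^ 2 ∂P = v) (a : ι → ℝ) :
    ∫ x, (∑ k, a k * X k x) ^ 2 ∂P = v * ∑ k, a k ^ 2 := by
  have hm : ∀ k, MemLp (fun x => a k * X k x) 2 P := fun k => (hX2 k).const_mul _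
  have hind : iIndepFun (fun k x => a k * X k x) P :=
    hX.comp (fun k u => a k * u) fun k => measurable_const_mul (a k)
  have h1 : ∀ k, ∫ x, a k * X k x ∂P = 0 := fun k => by rw [integral_const_mul, h0, mul_zero]
  have h2 : ∫ x, ∑ k, a k * X k x ∂P = 0 := by
    rw [integral_finsetSum _ fun k _ => (hm k).integrable (by norm_num)]
    simp [h1]
  have h3 := IndepFun.variance_sum (X := fun k x => a k * X k x) (μ := P) (s := Finset.univ)
    (fun k _ => hm k) fun i _ j _ hij => hind.indepFun hij
  rw [variance_of_integral_eq_zero (Finset.aemeasurable_sum _ fun k _ =>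
    (hm k).aestronglyMeasurable.aemeasurable) (by simpa using h2)] at h3
  simp only [Finset.sum_apply] at h3
  rw [h3, Finset.mul_sum]
  refine Finset.sum_congr rfl fun k _ => ?_
  rw [variance_of_integral_eq_zero (hm k).aestronglyMeasurable.aemeasurable (h1 k)]
  simp only [mul_pow]
  rw [integral_const_mul, hv, mul_comm]

end CharFun

/-! ### Convergence in distribution through characteristic functions -/

section Convergence

variable {κ E : Type*} [NormedAddCommGroup E] [InnerProductSpace ℝ E] [FiniteDimensional ℝ E]
  [MeasurableSpace E] [BorelSpace E] {Ω : κ → Type*} [∀ N, MeasurableSpace (Ω N)]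
  {P : ∀ N, Measure (Ω N)} [∀ N, IsProbabilityMeasure (P N)]

/-- Two sequences of random vectors whose difference tends to zero in probability have the same
limiting characteristic function. -/
lemma tendsto_integral_cexp_of_tendsto_measure {l : Filter κ} {X X' : ∀ N, Ω N → E}
    (hX : ∀ N, AEMeasurable (X N) (P N)) (hX' : ∀ N, AEMeasurable (X' N) (P N))
    (hdiff : ∀ δ : ℝ, 0 < δ → Tendsto (fun N => P N {x | δ ≤ ‖X N x - X' N x‖}) l (𝓝 0))
    {t : E} {z : ℂ}
    (h : Tendsto (fun N => ∫ x, Complex.exp (inner ℝ (X' N x) t * Complex.I) ∂(P N)) l (𝓝 z)) :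
    Tendsto (fun N => ∫ x, Complex.exp (inner ℝ (X N x) t * Complex.I) ∂(P N)) l (𝓝 z) := by
  have hint : ∀ {Y : ∀ N, Ω N → E}, (∀ N, AEMeasurable (Y N) (P N)) → ∀ N,
      Integrable (fun x => Complex.exp (inner ℝ (Y N x) t * Complex.I)) (P N) := by
    intro Y hY N
    refine Integrable.of_bound (C := 1) ?_ (ae_of_all _ fun x => ?_)
    · exact (by fun_prop : Continuous fun u : E =>
        Complex.exp (inner ℝ u t * Complex.I)).measurable.comp_aemeasurable (hY N)
          |>.aestronglyMeasurable
    · rw [Complex.norm_exp_ofReal_mul_I]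
  suffices hs : Tendsto (fun N => ∫ x, Complex.exp (inner ℝ (X N x) t * Complex.I) ∂(P N) -
      ∫ x, Complex.exp (inner ℝ (X' N x) t * Complex.I) ∂(P N)) l (𝓝 0) by
    simpa using hs.add h
  have hlip : ∀ u v : ℝ, ‖Complex.exp (u * Complex.I) - Complex.exp (v * Complex.I)‖ ≤
      |u - v| := fun u v => by
    have : Complex.exp (u * Complex.I) - Complex.exp (v * Complex.I) =
        Complex.exp (v * Complex.I) * (Complex.exp (Complex.I * (u - v : ℝ)) - 1) := by
      rw [mul_sub, ← Complex.exp_add, mul_one]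
      congr 2
      push_cast
      ring
    rw [this, norm_mul, Complex.norm_exp_ofReal_mul_I, one_mul]
    exact Real.norm_exp_I_mul_ofReal_sub_one_le
  rw [Metric.tendsto_nhds]
  intro ε hε
  -- Off the bad event the Lipschitz bound contributes at most ε/4; on it the difference is at most
  -- 2 and the probability below ε/4. Adding 1 covers t = 0.
  set δ := ε / (4 * (‖t‖ + 1)) with hδ
  have hδ0 : 0 < δ := by positivity
  have hδt : δ * ‖t‖ ≤ ε / 4 := by
    rw [hδ, div_mul_eq_mul_div, div_le_div_iff₀ (by positivity) (by norm_num)]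
    nlinarith [norm_nonneg t]
  have hev := (ENNReal.tendsto_toReal (by simp)).comp (hdiff δ hδ0)
  filter_upwards [hev.eventually_lt_const (u := ε / 4) (by rw [ENNReal.toReal_zero]; positivity)]
    with N hN
  simp only [Function.comp] at hN
  rw [dist_zero_right, ← integral_sub (hint hX N) (hint hX' N)]
  set S := {x | δ ≤ ‖X N x - X' N x‖} with hS
  have hSm : NullMeasurableSet S (P N) :=
    nullMeasurableSet_le aemeasurable_const ((hX N).sub (hX' N)).norm
  have hb : ∀ x, ‖Complex.exp (inner ℝ (X N x) t * Complex.I) -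
      Complex.exp (inner ℝ (X' N x) t * Complex.I)‖ ≤ δ * ‖t‖ + S.indicator (fun _ => 2) x := by
    intro x
    by_cases hx : x ∈ S
    · rw [Set.indicator_of_mem hx]
      refine (norm_sub_le _ _).trans ?_
      rw [Complex.norm_exp_ofReal_mul_I, Complex.norm_exp_ofReal_mul_I]
      have : 0 ≤ δ * ‖t‖ := by positivity
      linarith
    · rw [Set.indicator_of_notMem hx, add_zero]
      refine (hlip _ _).trans ?_
      rw [← inner_sub_left]
      refine (abs_real_inner_le_norm _ _).trans ?_
      have : ‖X N x - X' N x‖ < δ := not_le.mp hx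
      gcongr
  have hi : Integrable (S.indicator fun _ => (2 : ℝ)) (P N) :=
    (integrable_const (2 : ℝ)).indicator₀ hSm
  refine (norm_integral_le_of_norm_le ((integrable_const _).add hi) (ae_of_all _ hb)).trans_lt ?_
  rw [integral_add' (integrable_const _) hi, integral_indicator₀ hSm]
  simp only [integral_const, smul_eq_mul, measureReal_restrict_apply_univ, probReal_univ, one_mul]
  change (P N).real S < ε / 4 at hN
  linarith

/-- This is Lévy's continuity theorem, applied along sequences; the countably generated filter
permits that reduction. -/
lemma tendstoInDistribution_of_tendsto_integral_cexp {Ω' : Type*} [MeasurableSpace Ω']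
    {μ : Measure Ω'} [IsProbabilityMeasure μ] {l : Filter κ} [l.IsCountablyGenerated]
    {X : ∀ N, Ω N → E} {Z : Ω' → E} (hX : ∀ N, AEMeasurable (X N) (P N)) (hZ : AEMeasurable Z μ)
    (h : ∀ t, Tendsto (fun N => ∫ x, Complex.exp (inner ℝ (X N x) t * Complex.I) ∂(P N)) l
      (𝓝 (charFun (μ.map Z) t))) :
    TendstoInDistribution X l Z P μ := by
  refine ⟨hX, hZ, tendsto_of_seq_tendsto fun u hu => ?_⟩
  refine ProbabilityMeasure.tendsto_of_tendsto_charFun fun t => ?_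
  refine ((h t).comp hu).congr fun n => ?_
  simp only [Function.comp, ProbabilityMeasure.coe_mk]
  rw [charFun_apply, integral_map (hX _)]
  exact (by fun_prop : Continuous fun u : E =>
    Complex.exp (inner ℝ u t * Complex.I)).aestronglyMeasurable

end Convergence

/-! ### Block means of the noise -/

section BlockMean

variable {p₁ p₂ m n : ℕ}

/-- The size of a cluster. -/
def clusterSize {p m : ℕ} (τ : Fin m → Fin p) (a : Fin p) : ℝ := ∑ i, if τ i = a then (1 : ℝ) else 0

/-- The proportion of the entries of an `m × n` matrix that lie in a given block. -/
def blockProp (τ : Fin m → Fin p₁) (γ : Fin n → Fin p₂) (k : Fin p₂ × Fin p₁) : ℝ :=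
  clusterSize τ k.2 * clusterSize γ k.1 / (m * n)

lemma sum_comp_eq_sum_clusterSize (τ : Fin m → Fin p₁) (γ : Fin n → Fin p₂)
    (g : Fin p₂ × Fin p₁ → ℝ) :
    ∑ ij : Fin m × Fin n, g (γ ij.2, τ ij.1) =
      ∑ k, clusterSize τ k.2 * clusterSize γ k.1 * g k := by
  have h : ∀ ij : Fin m × Fin n, g (γ ij.2, τ ij.1) =
      ∑ k : Fin p₂ × Fin p₁,
        (if τ ij.1 = k.2 then (1 : ℝ) else 0) * (if γ ij.2 = k.1 then 1 else 0) * g k := by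
    intro ij
    rw [Finset.sum_eq_single (γ ij.2, τ ij.1)]
    · simp
    · rintro ⟨t, s⟩ _ hk
      by_cases h1 : τ ij.1 = s
      · have h2 : γ ij.2 ≠ t := fun h2 => hk (by rw [h1, h2])
        simp [h2]
      · simp [h1]
    · simp
  simp_rw [h]
  rw [Finset.sum_comm]
  refine Finset.sum_congr rfl fun k _ => ?_
  rw [← Finset.sum_mul, clusterSize, clusterSize, Finset.sum_mul_sum, Fintype.sum_prod_type]

lemma blockMean_apply (y : Matrix (Fin m) (Fin n) ℝ) (τ : Fin m → Fin p₁) (γ : Fin n → Fin p₂)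
    (s : Fin p₁) (t : Fin p₂) :
    blockMean y τ γ s t = (∑ i, ∑ j, if τ i = s ∧ γ j = t then y i j else 0) /
      (clusterSize τ s * clusterSize γ t) := by
  rw [blockMean, of_apply, clusterSize, clusterSize, Finset.sum_mul_sum]
  congr 1
  refine Finset.sum_congr rfl fun i _ => Finset.sum_congr rfl fun j _ => ?_
  by_cases h1 : τ i = s <;> by_cases h2 : γ j = t <;> simp [h1, h2]

/-- A linear combination of block means becomes a weighted sum over individual entries, the form
needed for sums of independent variables. -/
lemma sum_mul_blockMean (c : Fin p₂ × Fin p₁ → ℝ) (y : Matrix (Fin m) (Fin n) ℝ)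
    (τ : Fin m → Fin p₁) (γ : Fin n → Fin p₂) :
    ∑ k, c k * blockMean y τ γ k.2 k.1 =
      ∑ ij : Fin m × Fin n, c (γ ij.2, τ ij.1) /
        (clusterSize τ (τ ij.1) * clusterSize γ (γ ij.2)) * y ij.1 ij.2 := by
  have h : ∀ k : Fin p₂ × Fin p₁, c k * blockMean y τ γ k.2 k.1 =
      ∑ ij : Fin m × Fin n, if (γ ij.2, τ ij.1) = k then
        c k / (clusterSize τ k.2 * clusterSize γ k.1) * y ij.1 ij.2 else 0 := by
    intro k
    rw [blockMean_apply, ← mul_div_assoc, mul_div_right_comm, Fintype.sum_prod_type,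
      Finset.mul_sum]
    refine Finset.sum_congr rfl fun i _ => ?_
    rw [Finset.mul_sum]
    refine Finset.sum_congr rfl fun j _ => ?_
    simp only [mul_ite, mul_zero, Prod.ext_iff, and_comm]
  simp_rw [h]
  rw [Finset.sum_comm]
  refine Finset.sum_congr rfl fun ij _ => ?_
  rw [Finset.sum_ite_eq]
  simp

/-- Clusters must be nonempty: the mean over an empty block is 0/0 = 0, not the corresponding entry
of S₀. -/
lemma blockMean_eq_add {S₀ : Matrix (Fin p₁) (Fin p₂) ℝ} {τ : Fin m → Fin p₁} {γ : Fin n → Fin p₂}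
    {y e : Matrix (Fin m) (Fin n) ℝ} (hy : ∀ i j, y i j = S₀ (τ i) (γ j) + e i j)
    (hτ : ∀ s, clusterSize τ s ≠ 0) (hγ : ∀ t, clusterSize γ t ≠ 0) :
    blockMean y τ γ = S₀ + blockMean e τ γ := by
  ext s t
  rw [Matrix.add_apply, blockMean_apply, blockMean_apply]
  have h : (∑ i, ∑ j, if τ i = s ∧ γ j = t then y i j else 0) =
      S₀ s t * (clusterSize τ s * clusterSize γ t) +
        ∑ i, ∑ j, if τ i = s ∧ γ j = t then e i j else 0 := by
    rw [clusterSize, clusterSize, Finset.sum_mul_sum, Finset.mul_sum, ← Finset.sum_add_distrib]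
    refine Finset.sum_congr rfl fun i _ => ?_
    rw [Finset.mul_sum, ← Finset.sum_add_distrib]
    refine Finset.sum_congr rfl fun j _ => ?_
    by_cases h1 : τ i = s <;> by_cases h2 : γ j = t <;> simp [h1, h2, hy]
  rw [h, add_div, mul_div_assoc, div_self (mul_ne_zero (hτ s) (hγ t)), mul_one]

variable {Ω : Type*} [MeasurableSpace Ω] {P : Measure Ω} [IsProbabilityMeasure P]
  {e : Ω → Matrix (Fin m) (Fin n) ℝ} {τ : Fin m → Fin p₁} {γ : Fin n → Fin p₂} {v B : ℝ}

lemma sqrt_mul_sum_mul_blockMean (c : Fin p₂ × Fin p₁ → ℝ) (y : Matrix (Fin m) (Fin n) ℝ) :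
    √(m * n) * ∑ k, c k * blockMean y τ γ k.2 k.1 =
      ∑ ij : Fin m × Fin n, (√(m * n) * c (γ ij.2, τ ij.1) /
        (clusterSize τ (τ ij.1) * clusterSize γ (γ ij.2))) * y ij.1 ij.2 := by
  rw [sum_mul_blockMean, Finset.mul_sum]
  refine Finset.sum_congr rfl fun ij _ => ?_
  ring

lemma sum_sq_weights (hm : 0 < m) (hn : 0 < n) (hτ : ∀ s, clusterSize τ s ≠ 0)
    (hγ : ∀ t, clusterSize γ t ≠ 0) (c : Fin p₂ × Fin p₁ → ℝ) :
    ∑ ij : Fin m × Fin n, (√(m * n) * c (γ ij.2, τ ij.1) /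
        (clusterSize τ (τ ij.1) * clusterSize γ (γ ij.2))) ^ 2 =
      ∑ k, c k ^ 2 / blockProp τ γ k := by
  rw [sum_comp_eq_sum_clusterSize τ γ fun k => (√(m * n) * c k /
    (clusterSize τ k.2 * clusterSize γ k.1)) ^ 2]
  refine Finset.sum_congr rfl fun k _ => ?_
  have h1 := hτ k.2
  have h2 := hγ k.1
  rw [div_pow, mul_pow, Real.sq_sqrt (by positivity), blockProp]
  field_simp

/-- The characteristic function of the normalized block means of the noise. -/
lemma norm_integral_cexp_blockMean_sub_le (hm : 0 < m) (hn : 0 < n)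
    (hτ : ∀ s, 0 < clusterSize τ s) (hγ : ∀ t, 0 < clusterSize γ t)
    (hind : iIndepFun (fun (ij : Fin m × Fin n) x => e x ij.1 ij.2) P)
    (h3 : ∀ i j, MemLp (fun x => e x i j) 3 P) (h0 : ∀ i j, ∫ x, e x i j ∂P = 0) (hv0 : 0 ≤ v)
    (hv : ∀ i j, ∫ x, e x i j ^ 2 ∂P = v) (hB : ∀ i j, ∫ x, |e x i j| ^ 3 ∂P ≤ B)
    (c : Fin p₂ × Fin p₁ → ℝ) :
    ‖∫ x, Complex.exp ((√(m * n) * ∑ k, c k * blockMean (e x) τ γ k.2 k.1 : ℝ) * Complex.I) ∂P -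
      ((Real.exp (-(v * ∑ k, c k ^ 2 / blockProp τ γ k) / 2) : ℝ) : ℂ)‖ ≤
      ∑ k, (B * |c k| ^ 3 / (blockProp τ γ k ^ 2 * √(m * n)) +
        v ^ 2 * c k ^ 4 / (blockProp τ γ k ^ 3 * (m * n))) := by
  have h := norm_integral_cexp_sum_sub_le hind (fun ij => h3 ij.1 ij.2) (fun ij => h0 ij.1 ij.2)
    hv0 (fun ij => hv ij.1 ij.2) (fun ij => hB ij.1 ij.2)
    (fun ij => √(m * n) * c (γ ij.2, τ ij.1) /
        (clusterSize τ (τ ij.1) * clusterSize γ (γ ij.2)))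
  simp_rw [← sqrt_mul_sum_mul_blockMean] at h
  rw [sum_sq_weights hm hn (fun s => (hτ s).ne') fun t => (hγ t).ne'] at h
  refine h.trans (le_of_eq ?_)
  rw [sum_comp_eq_sum_clusterSize τ γ fun k => B * |√(m * n) * c k /
    (clusterSize τ k.2 * clusterSize γ k.1)| ^ 3 + v ^ 2 * (√(m * n) * c k /
    (clusterSize τ k.2 * clusterSize γ k.1)) ^ 4]
  refine Finset.sum_congr rfl fun k _ => ?_
  have h1 := hτ k.2
  have h2 := hγ k.1
  have hm' : (0 : ℝ) < m := by exact_mod_cast hm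
  have hn' : (0 : ℝ) < n := by exact_mod_cast hn
  obtain ⟨q, hq, hq2⟩ : ∃ q : ℝ, 0 < q ∧ q ^ 2 = m * n :=
    ⟨√(m * n), by positivity, Real.sq_sqrt (by positivity)⟩
  rw [blockProp, ← hq2, Real.sqrt_sq hq.le, abs_div, abs_mul, abs_of_pos hq,
    abs_of_pos (mul_pos h1 h2)]
  field_simp

/-- The second moment of the normalized block means of the noise. -/
lemma integral_norm_sq_blockMean (hm : 0 < m) (hn : 0 < n)
    (hτ : ∀ s, 0 < clusterSize τ s) (hγ : ∀ t, 0 < clusterSize γ t)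
    (hind : iIndepFun (fun (ij : Fin m × Fin n) x => e x ij.1 ij.2) P)
    (h2 : ∀ i j, MemLp (fun x => e x i j) 2 P) (h0 : ∀ i j, ∫ x, e x i j ∂P = 0)
    (hv : ∀ i j, ∫ x, e x i j ^ 2 ∂P = v) :
    Integrable (fun x => ‖√(m * n) • vecE (blockMean (e x) τ γ)‖ ^ 2) P ∧
    ∫ x, ‖√(m * n) • vecE (blockMean (e x) τ γ)‖ ^ 2 ∂P = ∑ k, v / blockProp τ γ k := by
  have hsum : ∀ x, ‖√(m * n) • vecE (blockMean (e x) τ γ)‖ ^ 2 =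
      ∑ k : Fin p₂ × Fin p₁, (√(m * n) * blockMean (e x) τ γ k.2 k.1) ^ 2 := fun x => by
    rw [EuclideanSpace.norm_sq_eq]
    refine Finset.sum_congr rfl fun k _ => ?_
    rw [Real.norm_eq_abs, sq_abs]
    rfl
  -- A single coordinate is the linear combination with an indicator as coefficient vector.
  have hcoord : ∀ (k : Fin p₂ × Fin p₁) x, √(m * n) * blockMean (e x) τ γ k.2 k.1 =
      ∑ ij : Fin m × Fin n, (√(m * n) * (Pi.single k 1 : Fin p₂ × Fin p₁ → ℝ) (γ ij.2, τ ij.1) /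
        (clusterSize τ (τ ij.1) * clusterSize γ (γ ij.2))) * e x ij.1 ij.2 := fun k x => by
    rw [← sqrt_mul_sum_mul_blockMean]
    simp [Pi.single_apply]
  have hint : ∀ k : Fin p₂ × Fin p₁,
      Integrable (fun x => (√(m * n) * blockMean (e x) τ γ k.2 k.1) ^ 2) P := fun k => by
    simp_rw [hcoord]
    exact (memLp_finsetSum _ fun ij _ => (h2 ij.1 ij.2).const_mul _).integrable_sq
  simp_rw [hsum]
  refine ⟨integrable_finsetSum _ fun k _ => hint k, ?_⟩
  rw [integral_finsetSum _ fun k _ => hint k]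
  refine Finset.sum_congr rfl fun k _ => ?_
  simp_rw [hcoord]
  rw [integral_sq_sum hind (fun ij => h2 ij.1 ij.2) (fun ij => h0 ij.1 ij.2)
    (fun ij => hv ij.1 ij.2), sum_sq_weights hm hn (fun s => (hτ s).ne') fun t => (hγ t).ne',
    Finset.sum_eq_single k]
  · rw [Pi.single_eq_same]; ring
  · intro k' _ hk'
    rw [Pi.single_eq_of_ne hk']; simp
  · simp

/-- Chebyshev's inequality, from the exact second moment. -/
lemma measure_le_norm_blockMean_le (hm : 0 < m) (hn : 0 < n)
    (hτ : ∀ s, 0 < clusterSize τ s) (hγ : ∀ t, 0 < clusterSize γ t)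
    (hind : iIndepFun (fun (ij : Fin m × Fin n) x => e x ij.1 ij.2) P)
    (h2 : ∀ i j, MemLp (fun x => e x i j) 2 P) (h0 : ∀ i j, ∫ x, e x i j ∂P = 0)
    (hv : ∀ i j, ∫ x, e x i j ^ 2 ∂P = v) {R : ℝ} (hR : 0 < R) :
    P {x | R ≤ ‖√(m * n) • vecE (blockMean (e x) τ γ)‖} ≤
      ENNReal.ofReal ((∑ k, v / blockProp τ γ k) / R ^ 2) := by
  obtain ⟨hi, he⟩ := integral_norm_sq_blockMean hm hn hτ hγ hind h2 h0 hv
  have h := mul_meas_ge_le_integral_of_nonneg (ae_of_all P fun x => by positivity) hi (R ^ 2)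
  rw [he] at h
  have hset : {x | R ^ 2 ≤ ‖√(m * n) • vecE (blockMean (e x) τ γ)‖ ^ 2} =
      {x | R ≤ ‖√(m * n) • vecE (blockMean (e x) τ γ)‖} := by
    ext x
    exact pow_le_pow_iff_left₀ hR.le (norm_nonneg _) two_ne_zero
  rw [hset] at h
  rw [← ofReal_measureReal]
  refine ENNReal.ofReal_le_ofReal ?_
  rw [le_div_iff₀ (by positivity), mul_comm]
  exact h

end BlockMean

/-! ### Permuted block mean matrices -/

section Permuted

variable {p₁ p₂ r : ℕ}

lemma permMatrix_mul_apply {p q : ℕ} (ω : Equiv.Perm (Fin p)) (M : Matrix (Fin p) (Fin q) ℝ)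
    (i : Fin p) (j : Fin q) : (ω.permMatrix ℝ * M) i j = M (ω i) j := by
  rw [Equiv.Perm.permMatrix, PEquiv.toMatrix_toPEquiv_mul, submatrix_apply, id]

lemma permMatrix_mul_transpose {p : ℕ} (ω : Equiv.Perm (Fin p)) :
    ω.permMatrix ℝ * (ω.permMatrix ℝ)ᵀ = 1 := by
  ext i j
  rw [permMatrix_mul_apply, transpose_apply, Equiv.Perm.permMatrix, PEquiv.toMatrix_apply]
  simp [one_apply, eq_comm]

lemma permuted_apply (S : Matrix (Fin p₁) (Fin p₂) ℝ) (ω : Equiv.Perm (Fin p₁))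
    (ι : Equiv.Perm (Fin p₂)) (s : Fin p₁) (t : Fin p₂) :
    permuted S ω ι s t = S (ω s) (ι t) := by
  rw [permuted, ← transpose_transpose (_ * _ * _), transpose_apply, transpose_mul,
    transpose_transpose, permMatrix_mul_apply, transpose_apply, permMatrix_mul_apply]

lemma permuted_add (S W : Matrix (Fin p₁) (Fin p₂) ℝ) (ω : Equiv.Perm (Fin p₁))
    (ι : Equiv.Perm (Fin p₂)) : permuted (S + W) ω ι = permuted S ω ι + permuted W ω ι := by
  simp [permuted, Matrix.mul_add, Matrix.add_mul]

lemma vec_permuted (S : Matrix (Fin p₁) (Fin p₂) ℝ) (ω : Equiv.Perm (Fin p₁))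
    (ι : Equiv.Perm (Fin p₂)) :
    vec (permuted S ω ι) = (ι.permMatrix ℝ ⊗ₖ ω.permMatrix ℝ) *ᵥ vec S := by
  rw [kronecker_mulVec_vec, permuted]

lemma norm_vecE_permuted (S : Matrix (Fin p₁) (Fin p₂) ℝ) (ω : Equiv.Perm (Fin p₁))
    (ι : Equiv.Perm (Fin p₂)) : ‖vecE (permuted S ω ι)‖ = ‖vecE S‖ := by
  rw [← sq_eq_sq₀ (norm_nonneg _) (norm_nonneg _), norm_vecE_sq, norm_vecE_sq, frobSq, frobSq]
  simp only [permuted_apply]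
  rw [Equiv.sum_comp ω fun s => ∑ t, S s (ι t) ^ 2]
  exact Finset.sum_congr rfl fun s _ => Equiv.sum_comp ι fun t => S s t ^ 2

/-- After relabelling by ω, the class called s is the original class ω⁻¹ s; this is where the
inverse permutations of the final statement originate. -/
lemma blockMean_comp {m n : ℕ} (y : Matrix (Fin m) (Fin n) ℝ) (τ : Fin m → Fin p₁)
    (γ : Fin n → Fin p₂) (ω : Equiv.Perm (Fin p₁)) (ι : Equiv.Perm (Fin p₂)) :
    blockMean y (ω ∘ τ) (ι ∘ γ) = permuted (blockMean y τ γ) ω⁻¹ ι⁻¹ := by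
  ext s t
  rw [permuted_apply]
  simp only [blockMean, of_apply, Function.comp, Equiv.Perm.eq_inv_iff_eq]

end Permuted

/-! ### Coordinates and the sandwich covariance -/

section Coordinates

variable {p₁ p₂ r : ℕ} {S₀ : Matrix (Fin p₁) (Fin p₂) ℝ} {V₁ : Matrix (Fin p₁) (Fin r) ℝ}
  {s : Fin r → ℝ} {V₂ : Matrix (Fin p₂) (Fin r) ℝ}

lemma IsCompactSVD.le (h : IsCompactSVD S₀ V₁ s V₂) : r ≤ p₂ := by
  have h1 := rank_mul_le_left V₂ᵀ V₂
  rw [h.stiefel_right, rank_one, Fintype.card_fin] at h1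
  simpa using h1.trans (rank_le_width V₂ᵀ)

/-- Existence of coordinates with strictly contractive `A` and `M` of full column rank. -/
lemma IsCompactSVD.exists_param (h : IsCompactSVD S₀ V₁ s V₂)
    (hV₂ : ∀ f : Fin r → Fin p₂, Function.Injective f → LinearIndependent ℝ (fun k => V₂ (f k)))
    (ω : Equiv.Perm (Fin p₁)) (ι : Equiv.Perm (Fin p₂)) :
    ∃ θ : Param p₁ p₂ r, θ ∈ paramSpace p₁ p₂ r ∧ sigmaMap θ = permuted S₀ ω ι ∧
      IsUnit ((matM θ)ᵀ * matM θ).det := by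
  have hr := h.le
  set V := ι.permMatrix ℝ * V₂ with hV
  have hP : ∀ {p : ℕ} (ω : Equiv.Perm (Fin p)), (ω.permMatrix ℝ)ᵀ * ω.permMatrix ℝ = 1 :=
    fun ω => mul_eq_one_comm.mp (permMatrix_mul_transpose ω)
  have hVV : Vᵀ * V = 1 := by
    rw [hV, transpose_mul, Matrix.mul_assoc, ← Matrix.mul_assoc (ι.permMatrix ℝ)ᵀ, hP,
      Matrix.one_mul, h.stiefel_right]
  -- The top block of Π₂V₂ consists of r distinct rows of V₂.
  have hT : IsUnit ((topEmbed p₂ r)ᵀ * V).det := by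
    rw [← isUnit_iff_isUnit_det, ← linearIndependent_rows_iff_isUnit]
    have : ((topEmbed p₂ r)ᵀ * V).row = fun k => V₂ (ι (Fin.castLE hr k)) := by
      ext k j
      rw [row_apply, mul_apply, Finset.sum_eq_single (Fin.castLE hr k)]
      · rw [hV, permMatrix_mul_apply]
        simp [topEmbed]
      · intro l _ hl
        have : (l : ℕ) ≠ k := fun h => hl (Fin.ext h)
        simp [topEmbed, this]
      · simp
    rw [this]
    exact hV₂ _ (ι.injective.comp (Fin.castLE_injective hr))
  obtain ⟨A, W, hA, hW, hU⟩ := exists_cayleyU_eq_mul hr hVV hT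
  have hW' : W * Wᵀ = 1 := mul_eq_one_comm.mp hW
  set N := ω.permMatrix ℝ * (V₁ * diagonal s) with hN
  -- With U = VW and W orthogonal, the rotation cancels in MUᵀ = NWWᵀVᵀ.
  set M := N * W with hM
  let θ : Param p₁ p₂ r :=
    WithLp.toLp 2 (Sum.elim (fun k => A k.2 k.1) (fun k => M k.2 k.1))
  have hθA : matA θ = A := rfl
  have hθM : matM θ = M := rfl
  refine ⟨θ, by rwa [paramSpace, Set.mem_ofPred_eq, hθA], ?_, ?_⟩
  · rw [sigmaMap, hθA, hθM, hU, transpose_mul, hM, Matrix.mul_assoc, ← Matrix.mul_assoc W, hW',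
      Matrix.one_mul, permuted, h.eq, hN, hV, transpose_mul]
    simp only [Matrix.mul_assoc]
  · have h1 : Nᵀ * N = diagonal fun k => s k * s k := by
      rw [hN, transpose_mul, transpose_mul, diagonal_transpose, Matrix.mul_assoc,
        ← Matrix.mul_assoc (ω.permMatrix ℝ)ᵀ, hP, Matrix.one_mul, Matrix.mul_assoc,
        ← Matrix.mul_assoc V₁ᵀ, h.stiefel_left, Matrix.one_mul, diagonal_mul_diagonal]
    rw [hθM, hM, transpose_mul, Matrix.mul_assoc, ← Matrix.mul_assoc Nᵀ, h1, ← Matrix.mul_assoc,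
      det_mul, det_mul, det_diagonal, mul_right_comm, ← det_mul, hW, det_one, one_mul,
      isUnit_iff_ne_zero]
    exact Finset.prod_ne_zero_iff.mpr fun k _ => (mul_pos (h.pos k) (h.pos k)).ne'

variable (h : IsCompactSVD S₀ V₁ s V₂)
  (hV₂ : ∀ f : Fin r → Fin p₂, Function.Injective f → LinearIndependent ℝ (fun k => V₂ (f k)))
  (ω : Equiv.Perm (Fin p₁)) (ι : Equiv.Perm (Fin p₂))

include h hV₂

lemma existsUnique_param :
    ∃! θ : Param p₁ p₂ r, θ ∈ paramSpace p₁ p₂ r ∧ sigmaMap θ = permuted S₀ ω ι := by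
  obtain ⟨θ, h1, h2, h3⟩ := h.exists_param hV₂ ω ι
  refine ⟨θ, ⟨h1, h2⟩, fun θ' hθ' => ?_⟩
  have h4 := eq_and_eq_of_mul_cayleyU_transpose_eq h.le h3 h1 (le_of_lt hθ'.1)
    (hθ'.2.trans h2.symm)
  ext k
  rcases k with ⟨j, i⟩ | ⟨j, i⟩
  · exact congrFun (congrFun h4.1 i) j
  · exact congrFun (congrFun h4.2 i) j

lemma coord_mem : coord r (permuted S₀ ω ι) ∈ paramSpace p₁ p₂ r :=
  Function.invFunOn_mem ((existsUnique_param h hV₂ ω ι).exists.imp fun _ hθ => hθ)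

lemma sigmaMap_coord : sigmaMap (coord r (permuted S₀ ω ι)) = permuted S₀ ω ι :=
  Function.invFunOn_eq ((existsUnique_param h hV₂ ω ι).exists.imp fun _ hθ => hθ)

lemma isUnit_det_matM_coord : IsUnit ((matM (coord r (permuted S₀ ω ι)))ᵀ *
    matM (coord r (permuted S₀ ω ι))).det := by
  obtain ⟨θ, h1, h2, h3⟩ := h.exists_param hV₂ ω ι
  rwa [(existsUnique_param h hV₂ ω ι).unique ⟨coord_mem h hV₂ ω ι, sigmaMap_coord h hV₂ ω ι⟩
    ⟨h1, h2⟩]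

lemma DSigma_coord_injective :
    Function.Injective (DSigma (coord r (permuted S₀ ω ι))).mulVec :=
  DSigma_mulVec_injective h.le (isUnit_det_matM_coord h hV₂ ω ι) (coord_mem h hV₂ ω ι)

lemma isUnit_det_transpose_mul_DSigma : IsUnit ((DSigma (coord r (permuted S₀ ω ι)))ᵀ *
    DSigma (coord r (permuted S₀ ω ι))).det := by
  have := PosDef.conjTranspose_mul_self _ (DSigma_coord_injective h hV₂ ω ι)
  rw [conjTranspose_eq_transpose_of_trivial] at this
  exact (isUnit_iff_isUnit_det _).mp this.isUnit

end Coordinates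

/-! ### Positivity and normalization of the sandwich covariance -/

section Sandwich

variable {p₁ p₂ r : ℕ}

/-- The matrix `(DᵀD)⁻¹ Dᵀ` of the linearized least-squares estimator. -/
def lsMatrix (r : ℕ) (S : Matrix (Fin p₁) (Fin p₂) ℝ) :
    Matrix (ParamIdx p₁ p₂ r) (Fin p₂ × Fin p₁) ℝ :=
  ((DSigma (coord r S))ᵀ * DSigma (coord r S))⁻¹ * (DSigma (coord r S))ᵀ

/-- The matrix `(DᵀD)⁻¹ Dᵀ (Π₂ ⊗ Π₁)`. -/
def lsPermMatrix (r : ℕ) (S : Matrix (Fin p₁) (Fin p₂) ℝ) (ω : Equiv.Perm (Fin p₁))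
    (ι : Equiv.Perm (Fin p₂)) : Matrix (ParamIdx p₁ p₂ r) (Fin p₂ × Fin p₁) ℝ :=
  lsMatrix r (permuted S ω ι) * (ι.permMatrix ℝ ⊗ₖ ω.permMatrix ℝ)

variable (S : Matrix (Fin p₁) (Fin p₂) ℝ) (σ : ℝ) (w : Fin p₁ → ℝ) (π : Fin p₂ → ℝ)
  (ω : Equiv.Perm (Fin p₁)) (ι : Equiv.Perm (Fin p₂))

lemma sandwichCov_eq : sandwichCov r S σ w π ω ι =
    lsPermMatrix r S ω ι * diagonal (vec (of fun s t => σ ^ 2 / (w s * π t))) *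
      (lsPermMatrix r S ω ι)ᵀ := by
  simp only [sandwichCov, lsPermMatrix, lsMatrix, transpose_mul, transpose_transpose,
    transpose_nonsing_inv, kroneckerMap_transpose, Matrix.mul_assoc]

variable {S σ w π ω ι}

/-- G is a congruence of a positive diagonal matrix by L = (DᵀD)⁻¹DᵀQ, with Q the permutation
factor. L has the right inverse QᵀD, hence full row rank. -/
lemma posDef_sandwichCov {V₁ : Matrix (Fin p₁) (Fin r) ℝ}
    {s : Fin r → ℝ} {V₂ : Matrix (Fin p₂) (Fin r) ℝ} (h : IsCompactSVD S V₁ s V₂)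
    (hV₂ : ∀ f : Fin r → Fin p₂, Function.Injective f → LinearIndependent ℝ (fun k => V₂ (f k)))
    (hσ : 0 < σ) (hw : ∀ a, 0 < w a) (hπ : ∀ b, 0 < π b) :
    (sandwichCov r S σ w π ω ι).PosDef := by
  rw [sandwichCov_eq, ← conjTranspose_eq_transpose_of_trivial (lsPermMatrix r S ω ι)]
  refine PosDef.mul_mul_conjTranspose_same (PosDef.diagonal fun k => ?_) ?_
  · have := hw k.2
    have := hπ k.1
    simp only [vec, of_apply]
    positivity
  · set D := DSigma (coord r (permuted S ω ι)) with hD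
    set Q := ι.permMatrix ℝ ⊗ₖ ω.permMatrix ℝ with hQ
    have hQQ : Q * Qᵀ = 1 := by
      rw [hQ, ← kroneckerMap_transpose, ← mul_kronecker_mul, permMatrix_mul_transpose,
        permMatrix_mul_transpose, one_kronecker_one]
    have hright : lsPermMatrix r S ω ι * (Qᵀ * D) = 1 := by
      rw [lsPermMatrix, Matrix.mul_assoc, ← Matrix.mul_assoc Q, hQQ, Matrix.one_mul, lsMatrix,
        Matrix.mul_assoc, nonsing_inv_mul _ (isUnit_det_transpose_mul_DSigma h hV₂ ω ι)]
    intro x y hxy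
    have := congrArg (fun z => z ᵥ* (Qᵀ * D)) hxy
    simpa only [vecMul_vecMul, hright, vecMul_one] using this

lemma invSqrt_transpose {κ : Type} [Fintype κ] [DecidableEq κ] (G : Matrix κ κ ℝ) :
    (invSqrt G)ᵀ = invSqrt G := by
  open scoped MatrixOrder in
  have := (CFC.sqrt_nonneg G).posSemidef.isHermitian
  rw [IsHermitian, conjTranspose_eq_transpose_of_trivial] at this
  rw [invSqrt, transpose_nonsing_inv, this]

open scoped MatrixOrder in
lemma invSqrt_mul_mul_invSqrt {κ : Type} [Fintype κ] [DecidableEq κ] {G : Matrix κ κ ℝ}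
    (hG : G.PosDef) : invSqrt G * G * invSqrt G = 1 := by
  have h1 : CFC.sqrt G * CFC.sqrt G = G := CFC.sqrt_mul_sqrt_self _ hG.posSemidef.nonneg
  have hu : IsUnit (CFC.sqrt G).det := by
    have h := (isUnit_iff_isUnit_det _).mp hG.isUnit
    rw [← h1, det_mul] at h
    exact isUnit_of_mul_isUnit_left h
  conv_lhs => rw [invSqrt]; enter [1, 2]; rw [← h1]
  rw [nonsing_inv_mul_cancel_left _ _ hu, mul_nonsing_inv _ hu]

/-- The standardized linear estimator has unit covariance. -/
lemma sum_sq_transpose_invSqrt_mulVec (hG : (sandwichCov r S σ w π ω ι).PosDef)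
    (t : ParamIdx p₁ p₂ r → ℝ) :
    ∑ k, σ ^ 2 / (w k.2 * π k.1) *
      (t ᵥ* (invSqrt (sandwichCov r S σ w π ω ι) * lsPermMatrix r S ω ι)) k ^ 2 = t ⬝ᵥ t := by
  set G := sandwichCov r S σ w π ω ι with hGdef
  set R := invSqrt G * lsPermMatrix r S ω ι with hR
  have h1 : R * diagonal (vec (of fun s t => σ ^ 2 / (w s * π t))) * Rᵀ = 1 := by
    rw [hR, transpose_mul, invSqrt_transpose, ← invSqrt_mul_mul_invSqrt hG]
    conv_rhs => enter [1, 2]; rw [hGdef, sandwichCov_eq]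
    simp only [Matrix.mul_assoc]
  have h2 : t ⬝ᵥ t = t ⬝ᵥ ((R * diagonal (vec (of fun s t => σ ^ 2 / (w s * π t))) * Rᵀ) *ᵥ t) := by
    rw [h1, one_mulVec]
  rw [h2, ← mulVec_mulVec, ← mulVec_mulVec, dotProduct_mulVec, mulVec_transpose, dotProduct]
  refine Finset.sum_congr rfl fun k _ => ?_
  rw [mulVec_diagonal, vec, of_apply]
  ring

end Sandwich

/-! ### Linearization of the least-squares estimator -/

section Linearization

variable {p₁ p₂ r : ℕ}

lemma isLeastSquares_iff {S : Matrix (Fin p₁) (Fin p₂) ℝ} {θ : Param p₁ p₂ r} :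
    IsLeastSquares S θ ↔ θ ∈ paramSpace p₁ p₂ r ∧
      IsMinOn (fun θ' => ‖vecE S - vecE (sigmaMap θ')‖) (paramSpace p₁ p₂ r) θ := by
  refine and_congr_right fun _ => forall_congr' fun θ' => imp_congr_right fun _ => ?_
  simp only [Set.mem_ofPred_eq]
  rw [← norm_vecE_sq, ← norm_vecE_sq, vecE_sub, vecE_sub,
    pow_le_pow_iff_left₀ (norm_nonneg _) (norm_nonneg _) two_ne_zero]

/-- The abstract least-squares results apply at each permuted truth: injectivity of D in finite
dimension gives the lower bound on ‖D x‖, and the normal equations give the orthogonality. -/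
lemma eventually_leastSquares_linearization {S₀ : Matrix (Fin p₁) (Fin p₂) ℝ}
    {V₁ : Matrix (Fin p₁) (Fin r) ℝ} {s : Fin r → ℝ} {V₂ : Matrix (Fin p₂) (Fin r) ℝ}
    (h : IsCompactSVD S₀ V₁ s V₂)
    (hV₂ : ∀ f : Fin r → Fin p₂, Function.Injective f → LinearIndependent ℝ (fun k => V₂ (f k)))
    (ω : Equiv.Perm (Fin p₁)) (ι : Equiv.Perm (Fin p₂)) {ε : ℝ} (hε : 0 < ε) :
    ∀ᶠ y in 𝓝 (vecE (permuted S₀ ω ι)), ∀ S, vecE S = y →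
      (∃ θ : Param p₁ p₂ r, IsLeastSquares S θ) ∧ ∀ θ : Param p₁ p₂ r, IsLeastSquares S θ →
        ‖θ - coord r (permuted S₀ ω ι) - toLpLin 2 2 (lsMatrix r (permuted S₀ ω ι))
          (vecE S - vecE (permuted S₀ ω ι))‖ ≤ ε * ‖vecE S - vecE (permuted S₀ ω ι)‖ := by
  set θ₀ := coord r (permuted S₀ ω ι) with hθ₀
  have hσ : sigmaMap θ₀ = permuted S₀ ω ι := sigmaMap_coord h hV₂ ω ι
  have hmem : θ₀ ∈ paramSpace p₁ p₂ r := coord_mem h hV₂ ω ι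
  have hΘ : paramSpace p₁ p₂ r ∈ 𝓝 θ₀ := isOpen_paramSpace.mem_nhds hmem
  have hinv := comap_vecE_sigmaMap_inf_le h.le (isUnit_det_matM_coord h hV₂ ω ι) hmem
  have hDinj : Function.Injective (DSigmaCLM θ₀) := fun x y hxy => by
    have : DSigma θ₀ *ᵥ x.ofLp = DSigma θ₀ *ᵥ y.ofLp := congrArg WithLp.ofLp hxy
    have h1 := DSigma_coord_injective h hV₂ ω ι this
    ext k
    exact congrFun h1 k
  obtain ⟨K, hK, hlip⟩ := (DSigmaCLM θ₀).toLinearMap.exists_antilipschitzWith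
    (LinearMap.ker_eq_bot.mpr hDinj)
  have hK' : (0 : ℝ) < K := hK
  have hD : ∀ x, (K : ℝ)⁻¹ * ‖x‖ ≤ ‖DSigmaCLM θ₀ x‖ := fun x => by
    have := hlip.le_mul_dist x 0
    simp only [map_zero, dist_zero_right] at this
    rw [inv_mul_le_iff₀ hK']
    exact this
  have hL : ∀ (z : EuclideanSpace ℝ (Fin p₂ × Fin p₁)) (x : Param p₁ p₂ r),
      inner ℝ (z - DSigmaCLM θ₀ ((toLpLin 2 2 (lsMatrix r (permuted S₀ ω ι))).toContinuousLinearMap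
        z)) (DSigmaCLM θ₀ x) = 0 := by
    intro z x
    have h1 : (DSigma θ₀)ᵀ * DSigma θ₀ * lsMatrix r (permuted S₀ ω ι) = (DSigma θ₀)ᵀ := by
      rw [lsMatrix, ← hθ₀, ← Matrix.mul_assoc,
        mul_nonsing_inv _ (isUnit_det_transpose_mul_DSigma h hV₂ ω ι), Matrix.one_mul]
    have h2 : (DSigma θ₀)ᵀ *ᵥ (z.ofLp - DSigma θ₀ *ᵥ (lsMatrix r (permuted S₀ ω ι) *ᵥ z.ofLp)) = 0 := by
      rw [mulVec_sub, mulVec_mulVec, mulVec_mulVec, h1, sub_self]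
    rw [EuclideanSpace.inner_eq_star_dotProduct]
    change (DSigma θ₀ *ᵥ x.ofLp) ⬝ᵥ
      (z.ofLp - DSigma θ₀ *ᵥ (lsMatrix r (permuted S₀ ω ι) *ᵥ z.ofLp)) = 0
    rw [dotProduct_comm, dotProduct_mulVec, ← mulVec_transpose, h2, zero_dotProduct]
  have e1 := eventually_norm_leastSquares_sub_le hΘ (hasFDerivAt_vecE_sigmaMap θ₀)
    (inv_pos.mpr hK') hD hL hinv hε
  have e2 := eventually_exists_leastSquares hΘ continuous_vecE_sigmaMap hinv
  simp only [hσ] at e1 e2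
  filter_upwards [e1, e2] with y h1 h2 S hS
  subst hS
  refine ⟨?_, fun θ hθ => ?_⟩
  · obtain ⟨θ, hθ, hmin⟩ := h2
    exact ⟨θ, isLeastSquares_iff.mpr ⟨hθ, hmin⟩⟩
  · exact h1 θ (isLeastSquares_iff.mp hθ).1 (isLeastSquares_iff.mp hθ).2

/-- The linearization holds uniformly over all permutations. -/
lemma exists_pos_leastSquares_linearization {S₀ : Matrix (Fin p₁) (Fin p₂) ℝ}
    {V₁ : Matrix (Fin p₁) (Fin r) ℝ} {s : Fin r → ℝ} {V₂ : Matrix (Fin p₂) (Fin r) ℝ}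
    (h : IsCompactSVD S₀ V₁ s V₂)
    (hV₂ : ∀ f : Fin r → Fin p₂, Function.Injective f → LinearIndependent ℝ (fun k => V₂ (f k)))
    {ε : ℝ} (hε : 0 < ε) :
    ∃ η > 0, ∀ (ω : Equiv.Perm (Fin p₁)) (ι : Equiv.Perm (Fin p₂)) (W : Matrix (Fin p₁) (Fin p₂) ℝ),
      ‖vecE W‖ < η → (∃ θ : Param p₁ p₂ r, IsLeastSquares (permuted (S₀ + W) ω ι) θ) ∧
        ∀ θ : Param p₁ p₂ r, IsLeastSquares (permuted (S₀ + W) ω ι) θ →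
          ‖θ - coord r (permuted S₀ ω ι) - toLpLin 2 2 (lsMatrix r (permuted S₀ ω ι))
            (vecE (permuted W ω ι))‖ ≤ ε * ‖vecE W‖ := by
  have key : ∀ ωι : Equiv.Perm (Fin p₁) × Equiv.Perm (Fin p₂), ∃ η > 0,
      ∀ W : Matrix (Fin p₁) (Fin p₂) ℝ, ‖vecE W‖ < η →
        (∃ θ : Param p₁ p₂ r, IsLeastSquares (permuted (S₀ + W) ωι.1 ωι.2) θ) ∧
        ∀ θ : Param p₁ p₂ r, IsLeastSquares (permuted (S₀ + W) ωι.1 ωι.2) θ →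
          ‖θ - coord r (permuted S₀ ωι.1 ωι.2) -
            toLpLin 2 2 (lsMatrix r (permuted S₀ ωι.1 ωι.2)) (vecE (permuted W ωι.1 ωι.2))‖ ≤
              ε * ‖vecE W‖ := by
    rintro ⟨ω, ι⟩
    obtain ⟨η, hη, hball⟩ := Metric.eventually_nhds_iff.mp
      (eventually_leastSquares_linearization h hV₂ ω ι hε)
    refine ⟨η, hη, fun W hW => ?_⟩
    have hsub : vecE (permuted (S₀ + W) ω ι) - vecE (permuted S₀ ω ι) = vecE (permuted W ω ι) := by
      rw [permuted_add, vecE_add, add_sub_cancel_left]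
    have h1 := hball (y := vecE (permuted (S₀ + W) ω ι))
      (by rwa [dist_eq_norm, hsub, norm_vecE_permuted]) _ rfl
    simpa only [hsub, norm_vecE_permuted] using h1
  choose η hη hprop using key
  -- The smallest radius over the finitely many pairs of permutations works for all of them.
  obtain ⟨k, hk⟩ := Finite.exists_min η
  exact ⟨η k, hη k, fun ω ι W hW => hprop (ω, ι) W (hW.trans_le (hk (ω, ι)))⟩

end Linearization

/-! ### Limits of the block means -/

section Limits

variable {p₁ p₂ : ℕ} {τ₀ : ∀ m : ℕ, Fin m → Fin p₁} {γ₀ : ∀ n : ℕ, Fin n → Fin p₂}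
  {w : Fin p₁ → ℝ} {π : Fin p₂ → ℝ}

lemma tendsto_fst_atTop : Tendsto (Prod.fst : ℕ × ℕ → ℕ) atTop atTop := by
  rw [← prod_atTop_atTop_eq]; exact tendsto_fst

lemma tendsto_snd_atTop : Tendsto (Prod.snd : ℕ × ℕ → ℕ) atTop atTop := by
  rw [← prod_atTop_atTop_eq]; exact tendsto_snd

lemma tendsto_mul_atTop : Tendsto (fun N : ℕ × ℕ => (N.1 : ℝ) * N.2) atTop atTop :=
  (tendsto_natCast_atTop_atTop.comp tendsto_fst_atTop).atTop_mul_atTop₀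
    (tendsto_natCast_atTop_atTop.comp tendsto_snd_atTop)

lemma eventually_clusterSize_pos {p : ℕ} {τ : ∀ m : ℕ, Fin m → Fin p} {w : Fin p → ℝ}
    (hw : ∀ a, 0 < w a)
    (hτ : ∀ a, Tendsto (fun m : ℕ => (1 / (m : ℝ)) * clusterSize (τ m) a) atTop (𝓝 (w a))) :
    ∀ᶠ m in atTop, 0 < m ∧ ∀ a, 0 < clusterSize (τ m) a := by
  refine (eventually_gt_atTop 0).and (eventually_all.mpr fun a => ?_)
  filter_upwards [(hτ a).eventually_const_lt (hw a), eventually_gt_atTop 0] with m h1 h2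
  have : (0 : ℝ) < 1 / m := by positivity
  exact pos_of_mul_pos_right h1 this.le

lemma tendsto_blockProp
    (hτ : ∀ a, Tendsto (fun m : ℕ => (1 / (m : ℝ)) * clusterSize (τ₀ m) a) atTop (𝓝 (w a)))
    (hγ : ∀ b, Tendsto (fun n : ℕ => (1 / (n : ℝ)) * clusterSize (γ₀ n) b) atTop (𝓝 (π b)))
    (k : Fin p₂ × Fin p₁) :
    Tendsto (fun N : ℕ × ℕ => blockProp (τ₀ N.1) (γ₀ N.2) k) atTop (𝓝 (w k.2 * π k.1)) := by
  refine (((hτ k.2).comp tendsto_fst_atTop).mul ((hγ k.1).comp tendsto_snd_atTop)).congr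
    fun N => ?_
  simp only [Function.comp, blockProp]
  ring

variable {Ω : ℕ × ℕ → Type*} [∀ N, MeasurableSpace (Ω N)]
  {P : ∀ N, Measure (Ω N)} [∀ N, IsProbabilityMeasure (P N)]
  {E : ∀ N : ℕ × ℕ, Ω N → Matrix (Fin N.1) (Fin N.2) ℝ} {v B : ℝ}

/-- A central limit theorem for linear combinations, with bounded coefficients, of the normalized
block means of the noise. -/
lemma tendsto_integral_cexp_blockMean (hw : ∀ a, 0 < w a) (hπ : ∀ b, 0 < π b)
    (hτ : ∀ a, Tendsto (fun m : ℕ => (1 / (m : ℝ)) * clusterSize (τ₀ m) a) atTop (𝓝 (w a)))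
    (hγ : ∀ b, Tendsto (fun n : ℕ => (1 / (n : ℝ)) * clusterSize (γ₀ n) b) atTop (𝓝 (π b)))
    (hind : ∀ N : ℕ × ℕ, iIndepFun (fun (ij : Fin N.1 × Fin N.2) x => E N x ij.1 ij.2) (P N))
    (h3 : ∀ N i j, MemLp (fun x => E N x i j) 3 (P N)) (h0 : ∀ N i j, ∫ x, E N x i j ∂(P N) = 0)
    (hv0 : 0 ≤ v) (hv : ∀ N i j, ∫ x, E N x i j ^ 2 ∂(P N) = v) (hB0 : 0 ≤ B)
    (hB : ∀ N i j, ∫ x, |E N x i j| ^ 3 ∂(P N) ≤ B)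
    {c : ℕ × ℕ → Fin p₂ × Fin p₁ → ℝ} {C q : ℝ} (hc : ∀ N k, |c N k| ≤ C)
    (hcq : ∀ N, ∑ k, v / (w k.2 * π k.1) * c N k ^ 2 = q) :
    Tendsto (fun N => ∫ x, Complex.exp ((√(N.1 * N.2) *
      ∑ k, c N k * blockMean (E N x) (τ₀ N.1) (γ₀ N.2) k.2 k.1 : ℝ) * Complex.I) ∂(P N)) atTop
      (𝓝 ((Real.exp (-q / 2) : ℝ) : ℂ)) := by
  set Q : ℕ × ℕ → Fin p₂ × Fin p₁ → ℝ := fun N => blockProp (τ₀ N.1) (γ₀ N.2) with hQ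
  have hq : ∀ k, Tendsto (fun N => Q N k) atTop (𝓝 (w k.2 * π k.1)) := tendsto_blockProp hτ hγ
  have hne : ∀ k : Fin p₂ × Fin p₁, w k.2 * π k.1 ≠ 0 := fun k => (mul_pos (hw _) (hπ _)).ne'
  -- The coefficients need not converge. They are bounded, and their quadratic form with the
  -- limiting proportions is exactly q, so only the error in the proportions has to vanish.
  have hvar : Tendsto (fun N => v * ∑ k, c N k ^ 2 / Q N k) atTop (𝓝 q) := by
    have h1 : Tendsto (fun N => ∑ k, C ^ 2 * |v / Q N k - v / (w k.2 * π k.1)|) atTop (𝓝 0) := by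
      have : Tendsto (fun N => ∑ k, C ^ 2 * |v / Q N k - v / (w k.2 * π k.1)|) atTop
          (𝓝 (∑ k : Fin p₂ × Fin p₁,
            C ^ 2 * |v / (w k.2 * π k.1) - v / (w k.2 * π k.1)|)) :=
        tendsto_finsetSum _ fun k _ =>
          (((tendsto_const_nhds.div (hq k) (hne k)).sub tendsto_const_nhds).abs).const_mul _
      simpa using this
    rw [tendsto_iff_norm_sub_tendsto_zero]
    refine squeeze_zero (fun _ => norm_nonneg _) (fun N => ?_) h1
    rw [← hcq N, Finset.mul_sum, ← Finset.sum_sub_distrib]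
    refine (norm_sum_le _ _).trans (Finset.sum_le_sum fun k _ => ?_)
    have : v * (c N k ^ 2 / Q N k) - v / (w k.2 * π k.1) * c N k ^ 2 =
        c N k ^ 2 * (v / Q N k - v / (w k.2 * π k.1)) := by ring
    rw [this, norm_mul, Real.norm_eq_abs, Real.norm_eq_abs, abs_pow]
    have := hc N k
    gcongr
  have herr : Tendsto (fun N : ℕ × ℕ => ∑ k : Fin p₂ × Fin p₁,
      (B * C ^ 3 / (Q N k ^ 2) * (√(N.1 * N.2))⁻¹ +
        v ^ 2 * C ^ 4 / (Q N k ^ 3) * ((N.1 : ℝ) * N.2)⁻¹)) atTop (𝓝 0) := by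
    have h1 : Tendsto (fun N : ℕ × ℕ => (√((N.1 : ℝ) * N.2))⁻¹) atTop (𝓝 0) :=
      tendsto_inv_atTop_zero.comp (Real.tendsto_sqrt_atTop.comp tendsto_mul_atTop)
    have h2 : Tendsto (fun N : ℕ × ℕ => ((N.1 : ℝ) * N.2)⁻¹) atTop (𝓝 0) :=
      tendsto_inv_atTop_zero.comp tendsto_mul_atTop
    have : Tendsto (fun N : ℕ × ℕ => ∑ k : Fin p₂ × Fin p₁,
      (B * C ^ 3 / (Q N k ^ 2) * (√(N.1 * N.2))⁻¹ +
        v ^ 2 * C ^ 4 / (Q N k ^ 3) * ((N.1 : ℝ) * N.2)⁻¹)) atTop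
        (𝓝 (∑ k : Fin p₂ × Fin p₁, (B * C ^ 3 / ((w k.2 * π k.1) ^ 2) * 0 +
          v ^ 2 * C ^ 4 / ((w k.2 * π k.1) ^ 3) * 0))) :=
      tendsto_finsetSum _ fun k _ =>
        ((tendsto_const_nhds.div ((hq k).pow 2) (pow_ne_zero 2 (hne k))).mul h1).add
          ((tendsto_const_nhds.div ((hq k).pow 3) (pow_ne_zero 3 (hne k))).mul h2)
    simpa using this
  have hexp : Tendsto (fun N => ((Real.exp (-(v * ∑ k, c N k ^ 2 / Q N k) / 2) : ℝ) : ℂ)) atTop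
      (𝓝 ((Real.exp (-q / 2) : ℝ) : ℂ)) :=
    (Complex.continuous_ofReal.tendsto _).comp ((Real.continuous_exp.tendsto _).comp
      (hvar.neg.div_const 2))
  have hdiff := squeeze_zero_norm' (f := fun N => ∫ x, Complex.exp ((√(N.1 * N.2) *
      ∑ k, c N k * blockMean (E N x) (τ₀ N.1) (γ₀ N.2) k.2 k.1 : ℝ) * Complex.I) ∂(P N) -
      ((Real.exp (-(v * ∑ k, c N k ^ 2 / Q N k) / 2) : ℝ) : ℂ)) ?_ herr
  · simpa using hdiff.add hexp
  · filter_upwards [tendsto_fst_atTop.eventually (eventually_clusterSize_pos hw hτ),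
      tendsto_snd_atTop.eventually (eventually_clusterSize_pos hπ hγ)] with N h1 h2
    refine (norm_integral_cexp_blockMean_sub_le h1.1 h2.1 h1.2 h2.2 (hind N) (h3 N) (h0 N) hv0
      (hv N) (hB N) (c N)).trans (Finset.sum_le_sum fun k _ => ?_)
    have hQ0 : 0 < Q N k := by
      have hm : (0 : ℝ) < N.1 := by exact_mod_cast h1.1
      have hn : (0 : ℝ) < N.2 := by exact_mod_cast h2.1
      have := h1.2 k.2
      have := h2.2 k.1
      simp only [hQ, blockProp]
      positivity
    have hck := hc N k
    have hc4 : c N k ^ 4 ≤ C ^ 4 := by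
      rw [← Even.pow_abs (by decide : Even 4)]
      gcongr
    rw [← div_eq_mul_inv, ← div_eq_mul_inv, div_div, div_div]
    gcongr

/-- The normalized block means of the noise are bounded in probability. -/
lemma eventually_measure_le_norm_blockMean_le (hw : ∀ a, 0 < w a) (hπ : ∀ b, 0 < π b)
    (hτ : ∀ a, Tendsto (fun m : ℕ => (1 / (m : ℝ)) * clusterSize (τ₀ m) a) atTop (𝓝 (w a)))
    (hγ : ∀ b, Tendsto (fun n : ℕ => (1 / (n : ℝ)) * clusterSize (γ₀ n) b) atTop (𝓝 (π b)))
    (hind : ∀ N : ℕ × ℕ, iIndepFun (fun (ij : Fin N.1 × Fin N.2) x => E N x ij.1 ij.2) (P N))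
    (h2 : ∀ N i j, MemLp (fun x => E N x i j) 2 (P N)) (h0 : ∀ N i j, ∫ x, E N x i j ∂(P N) = 0)
    (hv : ∀ N i j, ∫ x, E N x i j ^ 2 ∂(P N) = v) :
    ∃ M : ℝ, ∀ᶠ N : ℕ × ℕ in atTop, ∀ R : ℝ, 0 < R →
      P N {x | R ≤ ‖√(N.1 * N.2) • vecE (blockMean (E N x) (τ₀ N.1) (γ₀ N.2))‖} ≤
        ENNReal.ofReal (M / R ^ 2) := by
  have hlim : Tendsto (fun N : ℕ × ℕ => ∑ k, v / blockProp (τ₀ N.1) (γ₀ N.2) k) atTop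
      (𝓝 (∑ k : Fin p₂ × Fin p₁, v / (w k.2 * π k.1))) :=
    tendsto_finsetSum _ fun k _ => tendsto_const_nhds.div (tendsto_blockProp hτ hγ k)
      (mul_pos (hw _) (hπ _)).ne'
  -- The added 1 is slack above the limit, so that the second moments lie below M eventually.
  refine ⟨∑ k : Fin p₂ × Fin p₁, v / (w k.2 * π k.1) + 1, ?_⟩
  filter_upwards [tendsto_fst_atTop.eventually (eventually_clusterSize_pos hw hτ),
    tendsto_snd_atTop.eventually (eventually_clusterSize_pos hπ hγ),
    hlim.eventually_le_const (lt_add_one _)] with N h1 h2' hM R hR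
  refine (measure_le_norm_blockMean_le h1.1 h2'.1 h1.2 h2'.2 (hind N) (h2 N) (h0 N) (hv N)
    hR).trans (ENNReal.ofReal_le_ofReal ?_)
  gcongr

lemma tendsto_ofReal_div_sq (M : ℝ) :
    Tendsto (fun R : ℝ => ENNReal.ofReal (M / R ^ 2)) atTop (𝓝 0) := by
  have h : Tendsto (fun R : ℝ => M / R ^ 2) atTop (𝓝 0) :=
    tendsto_const_nhds.div_atTop (tendsto_pow_atTop two_ne_zero)
  have h' := (ENNReal.continuous_ofReal.tendsto 0).comp h
  rw [ENNReal.ofReal_zero] at h'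
  exact h'

/-- If the normalized vectors are bounded in probability, the vectors are small. -/
lemma tendsto_measure_le_norm_of_bounded {Ω : ℕ × ℕ → Type*} [∀ N, MeasurableSpace (Ω N)]
    {P : ∀ N, Measure (Ω N)} {F : Type*} [NormedAddCommGroup F] [NormedSpace ℝ F]
    {Z : ∀ N : ℕ × ℕ, Ω N → F} {M : ℝ}
    (h : ∀ᶠ N : ℕ × ℕ in atTop, ∀ R : ℝ, 0 < R →
      P N {x | R ≤ ‖√(N.1 * N.2) • Z N x‖} ≤ ENNReal.ofReal (M / R ^ 2)) {η : ℝ} (hη : 0 < η) :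
    Tendsto (fun N => P N {x | η ≤ ‖Z N x‖}) atTop (𝓝 0) := by
  have hs : Tendsto (fun N : ℕ × ℕ => √((N.1 : ℝ) * N.2) * η) atTop atTop :=
    (Real.tendsto_sqrt_atTop.comp tendsto_mul_atTop).atTop_mul_const hη
  refine tendsto_of_tendsto_of_tendsto_of_le_of_le' tendsto_const_nhds
    ((tendsto_ofReal_div_sq M).comp hs) (Eventually.of_forall fun _ => zero_le) ?_
  filter_upwards [h, hs.eventually_gt_atTop 0] with N h1 h2
  refine (measure_mono fun x hx => ?_).trans (h1 _ h2)
  simp only [Set.mem_ofPred_eq] at hx ⊢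
  rw [norm_smul, Real.norm_eq_abs, abs_of_nonneg (Real.sqrt_nonneg _)]
  gcongr

end Limits

/-! ### Standardization of the least-squares estimator -/

section Standardization

variable {p₁ p₂ r : ℕ}

/-- The permutations move from the noise into the matrix, so the linear part always acts on the same
unpermuted noise W. -/
lemma toEuclideanCLM_sub_toLpLin (B : Matrix (ParamIdx p₁ p₂ r) (ParamIdx p₁ p₂ r) ℝ)
    (S W : Matrix (Fin p₁) (Fin p₂) ℝ) (ω : Equiv.Perm (Fin p₁)) (ι : Equiv.Perm (Fin p₂))
    (u : Param p₁ p₂ r) :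
    toEuclideanCLM (𝕜 := ℝ) B u - toLpLin 2 2 (B * lsPermMatrix r S ω ι) (vecE W) =
      toEuclideanCLM (𝕜 := ℝ) B
        (u - toLpLin 2 2 (lsMatrix r (permuted S ω ι)) (vecE (permuted W ω ι))) := by
  rw [map_sub]
  congr 1
  refine (WithLp.ofLp_injective 2) ?_
  change (B * lsPermMatrix r S ω ι) *ᵥ vec W =
    B *ᵥ (lsMatrix r (permuted S ω ι) *ᵥ vec (permuted W ω ι))
  rw [vec_permuted, lsPermMatrix, mulVec_mulVec, mulVec_mulVec, Matrix.mul_assoc]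

lemma inner_toLpLin_vecE {κ : Type*} [Fintype κ] (B : Matrix κ (Fin p₂ × Fin p₁) ℝ)
    (W : Matrix (Fin p₁) (Fin p₂) ℝ) (t : EuclideanSpace ℝ κ) :
    inner ℝ (toLpLin 2 2 B (vecE W)) t = ∑ k, (t.ofLp ᵥ* B) k * W k.2 k.1 := by
  rw [EuclideanSpace.inner_eq_star_dotProduct]
  change t.ofLp ⬝ᵥ (B *ᵥ vec W) = _
  rw [dotProduct_mulVec]
  rfl

lemma measurable_vecE_blockMean {Ω : Type*} [MeasurableSpace Ω] {m n : ℕ}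
    {e : Ω → Matrix (Fin m) (Fin n) ℝ} (he : ∀ i j, Measurable fun x => e x i j)
    (τ : Fin m → Fin p₁) (γ : Fin n → Fin p₂) :
    Measurable fun x => vecE (blockMean (e x) τ γ) := by
  refine (WithLp.measurable_toLp 2 _).comp (measurable_pi_lambda _ fun k => ?_)
  simp only [vec, blockMean, of_apply]
  refine Measurable.div_const (Finset.measurable_fun_sum _ fun i _ =>
    Finset.measurable_fun_sum _ fun j _ => ?_) _
  split_ifs
  · exact he i j
  · exact measurable_const

end Standardization

end

end Biclustering

/-! ### Assembly of the theorem -/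

theorem theorem4p4
    -- the block mean matrix, its rank and its singular value decomposition
    {p₁ p₂ r : ℕ} (S₀ : Matrix (Fin p₁) (Fin p₂) ℝ) (hrank : S₀.rank = r)
    (V₁ : Matrix (Fin p₁) (Fin r) ℝ) (s : Fin r → ℝ) (V₂ : Matrix (Fin p₂) (Fin r) ℝ)
    (hsvd : IsCompactSVD S₀ V₁ s V₂)
    -- any `r` rows of `V₂` are linearly independent
    (hV₂ : ∀ f : Fin r → Fin p₂, Function.Injective f → LinearIndependent ℝ (fun k => V₂ (f k)))
    -- the true cluster assignments and the limiting cluster proportions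
    (τ₀ : ∀ m : ℕ, Fin m → Fin p₁) (γ₀ : ∀ n : ℕ, Fin n → Fin p₂)
    (w : Fin p₁ → ℝ) (π : Fin p₂ → ℝ)
    (hw : w ∈ stdSimplex ℝ (Fin p₁)) (hπ : π ∈ stdSimplex ℝ (Fin p₂))
    (hw_pos : ∀ a, 0 < w a) (hπ_pos : ∀ b, 0 < π b)
    (hτ₀ : ∀ a, Tendsto (fun m : ℕ => (1 / (m : ℝ)) * ∑ i, if τ₀ m i = a then (1 : ℝ) else 0)
      atTop (𝓝 (w a)))
    (hγ₀ : ∀ b, Tendsto (fun n : ℕ => (1 / (n : ℝ)) * ∑ j, if γ₀ n j = b then (1 : ℝ) else 0)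
      atTop (𝓝 (π b)))
    -- for each `(m, n)`, the data matrix, whose noise has independent, identically distributed,
    -- centred sub-Gaussian entries with variance `σ ^ 2`
    {Ω : ℕ × ℕ → Type*} [∀ N, MeasurableSpace (Ω N)]
    (P : ∀ N, Measure (Ω N)) [∀ N, IsProbabilityMeasure (P N)]
    (Y : ∀ N : ℕ × ℕ, Ω N → Matrix (Fin N.1) (Fin N.2) ℝ)
    (E : ∀ N : ℕ × ℕ, Ω N → Matrix (Fin N.1) (Fin N.2) ℝ)
    (hY : ∀ N x i j, Y N x i j = S₀ (τ₀ N.1 i) (γ₀ N.2 j) + E N x i j)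
    (hE_meas : ∀ N i j, Measurable (fun x => E N x i j))
    (hE_indep : ∀ N : ℕ × ℕ,
      iIndepFun (fun (ij : Fin N.1 × Fin N.2) (x : Ω N) => E N x ij.1 ij.2) (P N))
    (hE_ident : ∀ (N : ℕ × ℕ) (i i' : Fin N.1) (j j' : Fin N.2),
      IdentDistrib (fun x => E N x i j) (fun x => E N x i' j') (P N) (P N))
    (hE_mean : ∀ N i j, ∫ x, E N x i j ∂(P N) = 0)
    (σ : ℝ) (hσ : 0 < σ)
    (hE_var : ∀ N i j, variance (fun x => E N x i j) (P N) = σ ^ 2)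
    (K : ℝ≥0) (hE_subG : ∀ N i j, HasSubgaussianMGF (fun x => E N x i j) K (P N))
    -- strongly consistent estimators of the cluster assignments
    (τhat : ∀ N : ℕ × ℕ, Ω N → Fin N.1 → Fin p₁) (γhat : ∀ N : ℕ × ℕ, Ω N → Fin N.2 → Fin p₂)
    (hτhat : ∀ N, Measurable (τhat N)) (hγhat : ∀ N, Measurable (γhat N))
    (hcons : ∃ (ω : ℕ → Equiv.Perm (Fin p₁)) (ι : ℕ → Equiv.Perm (Fin p₂)),
      Tendsto (fun N : ℕ × ℕ => P N {x | hammingDist (τhat N x) (ω N.1 ∘ τ₀ N.1) = 0 ∧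
        hammingDist (γhat N x) (ι N.2 ∘ γ₀ N.2) = 0}) atTop (𝓝 1))
    -- the least-squares estimator: a minimizer whenever there is one
    (θhat : ∀ N : ℕ × ℕ, Ω N → Param p₁ p₂ r) (hθhat : ∀ N, Measurable (θhat N))
    (hLS : ∀ N : ℕ × ℕ, ∀ᵐ x ∂(P N),
      (∃ θ : Param p₁ p₂ r, IsLeastSquares (blockMean (Y N x) (τhat N x) (γhat N x)) θ) →
        IsLeastSquares (blockMean (Y N x) (τhat N x) (γhat N x)) (θhat N x)) :
    -- the coordinates and the covariance matrix are well defined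
    (∀ (ω : Equiv.Perm (Fin p₁)) (ι : Equiv.Perm (Fin p₂)),
      (∃! θ : Param p₁ p₂ r, θ ∈ paramSpace p₁ p₂ r ∧ sigmaMap θ = permuted S₀ ω ι) ∧
      (sandwichCov r S₀ σ w π ω ι).PosDef) ∧
    -- a minimizer exists with probability tending to one
    Tendsto (fun N : ℕ × ℕ => P N {x | ∃ θ : Param p₁ p₂ r,
      IsLeastSquares (blockMean (Y N x) (τhat N x) (γhat N x)) θ}) atTop (𝓝 1) ∧
    -- asymptotic normality
    ∃ (ω : ℕ → Equiv.Perm (Fin p₁)) (ι : ℕ → Equiv.Perm (Fin p₂)),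
      TendstoInDistribution
        (fun (N : ℕ × ℕ) (x : Ω N) => Real.sqrt ((N.1 : ℝ) * (N.2 : ℝ)) •
          toEuclideanCLM (𝕜 := ℝ) (invSqrt (sandwichCov r S₀ σ w π (ω N.1) (ι N.2)))
            (θhat N x - coord r (permuted S₀ (ω N.1) (ι N.2))))
        atTop (id : Param p₁ p₂ r → Param p₁ p₂ r) P
        (multivariateGaussian (0 : Param p₁ p₂ r) 1) := by
  classical
  obtain ⟨ω, ι, hcons⟩ := hcons
  have hG : ∀ (ω : Equiv.Perm (Fin p₁)) (ι : Equiv.Perm (Fin p₂)),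
      (sandwichCov r S₀ σ w π ω ι).PosDef := fun ω ι =>
    posDef_sandwichCov hsvd hV₂ hσ hw_pos hπ_pos
  set W : ∀ N, Ω N → Matrix (Fin p₁) (Fin p₂) ℝ :=
    fun N x => blockMean (E N x) (τ₀ N.1) (γ₀ N.2) with hW
  -- the noise
  have hLp : ∀ N i j (q : ℝ≥0), MemLp (fun x => E N x i j) q (P N) := fun N i j q =>
    (hE_subG N i j).memLp q
  have h2 : ∀ N i j, MemLp (fun x => E N x i j) 2 (P N) := fun N i j => by
    simpa using hLp N i j 2
  have h3 : ∀ N i j, MemLp (fun x => E N x i j) 3 (P N) := fun N i j => by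
    simpa using hLp N i j 3
  have hv : ∀ N i j, ∫ x, E N x i j ^ 2 ∂(P N) = σ ^ 2 := fun N i j => by
    rw [← hE_var N i j, variance_of_integral_eq_zero (hE_meas N i j).aemeasurable (hE_mean N i j)]
  have hWm : ∀ N, Measurable fun x => vecE (W N x) := fun N =>
    measurable_vecE_blockMean (hE_meas N) _ _
  obtain ⟨M, hM⟩ := eventually_measure_le_norm_blockMean_le hw_pos hπ_pos hτ₀ hγ₀ hE_indep h2
    hE_mean hv
  have hsmall : ∀ {η : ℝ}, 0 < η → Tendsto (fun N => P N {x | η ≤ ‖vecE (W N x)‖}) atTop (𝓝 0) :=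
    fun hη => tendsto_measure_le_norm_of_bounded hM hη
  -- consistency of the estimated clusters
  set bad : ∀ N, Set (Ω N) := fun N => {x | hammingDist (τhat N x) (ω N.1 ∘ τ₀ N.1) = 0 ∧
        hammingDist (γhat N x) (ι N.2 ∘ γ₀ N.2) = 0}ᶜ with hbad
  have hbad0 : Tendsto (fun N => P N (bad N)) atTop (𝓝 0) := by
    have hmeas : ∀ N : ℕ × ℕ, MeasurableSet {x | hammingDist (τhat N x) (ω N.1 ∘ τ₀ N.1) = 0 ∧
        hammingDist (γhat N x) (ι N.2 ∘ γ₀ N.2) = 0} := fun N => by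
      simp only [hammingDist_eq_zero]
      exact (hτhat N (measurableSet_singleton _)).inter (hγhat N (measurableSet_singleton _))
    simp only [hbad, fun N => prob_compl_eq_one_sub (μ := P N) (hmeas N)]
    simpa using ENNReal.Tendsto.sub (tendsto_const_nhds (x := (1 : ENNReal))) hcons
      (Or.inl (by simp))
  have hgood : ∀ᶠ N : ℕ × ℕ in atTop, ∀ x, x ∉ bad N →
      blockMean (Y N x) (τhat N x) (γhat N x) =
        permuted (S₀ + W N x) (ω N.1)⁻¹ (ι N.2)⁻¹ := by
    filter_upwards [tendsto_fst_atTop.eventually (eventually_clusterSize_pos hw_pos hτ₀),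
      tendsto_snd_atTop.eventually (eventually_clusterSize_pos hπ_pos hγ₀)] with N h1 h2 x hx
    simp only [hbad, Set.mem_compl_iff, not_not, Set.mem_ofPred_eq, hammingDist_eq_zero] at hx
    rw [hx.1, hx.2, blockMean_comp, blockMean_eq_add (hY N x) (fun s => (h1.2 s).ne')
      fun t => (h2.2 t).ne']
  -- The permutations are the inverses of those in the consistency hypothesis, as dictated by
  -- `blockMean_comp`.
  refine ⟨fun ω ι => ⟨existsUnique_param hsvd hV₂ ω ι, hG ω ι⟩, ?_,
    fun m => (ω m)⁻¹, fun n => (ι n)⁻¹, ?_⟩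
  · obtain ⟨η, hη, hlin⟩ := exists_pos_leastSquares_linearization hsvd hV₂ one_pos
    have hlim : Tendsto (fun N => 1 - (P N (bad N) + P N {x | η ≤ ‖vecE (W N x)‖})) atTop
        (𝓝 1) := by
      simpa using ENNReal.Tendsto.sub (tendsto_const_nhds (x := (1 : ENNReal)))
        (hbad0.add (hsmall hη)) (Or.inl (by simp))
    refine tendsto_of_tendsto_of_tendsto_of_le_of_le' hlim tendsto_const_nhds ?_
      (Eventually.of_forall fun N => prob_le_one)
    filter_upwards [hgood] with N hN
    -- Covering the space by the existence event and two exceptional sets uses only subadditivity,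
    -- so measurability of the existence event is not needed.
    rw [tsub_le_iff_right, ← measure_univ (μ := P N)]
    refine (measure_mono fun x _ => ?_).trans
      ((measure_union_le _ _).trans (add_le_add le_rfl (measure_union_le _ _)))
    by_cases hx : x ∈ bad N
    · exact Or.inr (Or.inl hx)
    by_cases hx' : η ≤ ‖vecE (W N x)‖
    · exact Or.inr (Or.inr hx')
    · left
      rw [Set.mem_ofPred_eq, hN x hx]
      exact (hlin _ _ _ (not_le.mp hx')).1
  · set T : Equiv.Perm (Fin p₁) → Equiv.Perm (Fin p₂) →
        Matrix (ParamIdx p₁ p₂ r) (ParamIdx p₁ p₂ r) ℝ :=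
      fun ω ι => invSqrt (sandwichCov r S₀ σ w π ω ι) with hT
    obtain ⟨C, hC0, hC⟩ : ∃ C : ℝ, 0 ≤ C ∧ ∀ ω ι, ‖toEuclideanCLM (𝕜 := ℝ) (T ω ι)‖ ≤ C := by
      obtain ⟨k, hk⟩ := Finite.exists_max fun k : Equiv.Perm (Fin p₁) × Equiv.Perm (Fin p₂) =>
        ‖toEuclideanCLM (𝕜 := ℝ) (T k.1 k.2)‖
      exact ⟨_, norm_nonneg _, fun ω ι => hk (ω, ι)⟩
    -- X' is the linear part of the standardized estimator; it is measurable and handled by the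
    -- central limit theorem.
    set X' : ∀ N, Ω N → Param p₁ p₂ r := fun N x => √((N.1 : ℝ) * N.2) •
      toLpLin 2 2 (T (ω N.1)⁻¹ (ι N.2)⁻¹ * lsPermMatrix r S₀ (ω N.1)⁻¹ (ι N.2)⁻¹)
        (vecE (W N x)) with hX'
    have hXm : ∀ N : ℕ × ℕ, Measurable fun x => √((N.1 : ℝ) * N.2) •
        toEuclideanCLM (𝕜 := ℝ) (T (ω N.1)⁻¹ (ι N.2)⁻¹)
          (θhat N x - coord r (permuted S₀ (ω N.1)⁻¹ (ι N.2)⁻¹)) := fun N => by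
      have h1 := (hθhat N).sub_const (coord r (permuted S₀ (ω N.1)⁻¹ (ι N.2)⁻¹))
      exact ((toEuclideanCLM (𝕜 := ℝ) (T (ω N.1)⁻¹ (ι N.2)⁻¹)).continuous.measurable.comp
        h1).const_smul (√((N.1 : ℝ) * N.2))
    have hX'm : ∀ N, Measurable (X' N) := fun N =>
      (((toLpLin 2 2 (T (ω N.1)⁻¹ (ι N.2)⁻¹ * lsPermMatrix r S₀ (ω N.1)⁻¹ (ι N.2)⁻¹)
        ).continuous_of_finiteDimensional.measurable).comp (hWm N)).const_smul
          (√((N.1 : ℝ) * N.2))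
    refine tendstoInDistribution_of_tendsto_integral_cexp (fun N => (hXm N).aemeasurable)
      aemeasurable_id fun t => ?_
    refine tendsto_integral_cexp_of_tendsto_measure (X' := X') (fun N => (hXm N).aemeasurable)
      (fun N => (hX'm N).aemeasurable) (fun δ hδ => ?_) ?_
    · rw [ENNReal.tendsto_nhds_zero]
      intro e he
      -- R is fixed first, so that ‖√(mn) W‖ ≥ R is unlikely; the linearization accuracy is then
      -- chosen so that after multiplication by C and R the error is at most δ/2.
      obtain ⟨R, hRe, hR⟩ := ((((tendsto_ofReal_div_sq M).eventually_le_const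
        (ENNReal.half_pos he.ne')).and (eventually_gt_atTop 0))).exists
      obtain ⟨η, hη, hlin⟩ := exists_pos_leastSquares_linearization hsvd hV₂
        (ε := δ / (2 * (C + 1) * R)) (by positivity)
      have hsum := hbad0.add (hsmall hη)
      rw [add_zero] at hsum
      filter_upwards [hgood, hM, hsum.eventually_le_const (ENNReal.half_pos he.ne')]
        with N hN hMN hsN
      rw [← ENNReal.add_halves e]
      refine le_trans ?_ (add_le_add hsN ((hMN R hR).trans hRe))
      refine le_trans ?_ ((measure_union_le _ _).trans (add_le_add (measure_union_le _ _) le_rfl))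
      refine measure_mono_ae ?_
      filter_upwards [hLS N] with x hx hxδ
      by_cases h1 : x ∈ bad N
      · exact Or.inl (Or.inl h1)
      by_cases h2 : η ≤ ‖vecE (W N x)‖
      · exact Or.inl (Or.inr h2)
      right
      by_contra h3
      have h3' : ‖√((N.1 : ℝ) * N.2) • vecE (W N x)‖ < R := not_le.mp h3
      rw [hN x h1] at hx
      obtain ⟨hex, hle⟩ := hlin (ω N.1)⁻¹ (ι N.2)⁻¹ (W N x) (not_le.mp h2)
      have hb := hle _ (hx hex)
      have hxδ' : δ ≤ ‖_‖ := hxδ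
      rw [← smul_sub, toEuclideanCLM_sub_toLpLin, norm_smul] at hxδ'
      rw [norm_smul] at h3'
      have hop := ContinuousLinearMap.le_of_opNorm_le_of_le _ (hC (ω N.1)⁻¹ (ι N.2)⁻¹) hb
      -- Outside all exceptional events the standardized remainder cannot reach δ.
      have : δ ≤ δ / 2 := calc
        δ ≤ ‖√((N.1 : ℝ) * N.2)‖ * (C * (δ / (2 * (C + 1) * R) * ‖vecE (W N x)‖)) :=
          hxδ'.trans (by gcongr)
        _ = C * (δ / (2 * (C + 1) * R)) * (‖√((N.1 : ℝ) * N.2)‖ * ‖vecE (W N x)‖) := by ring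
        _ ≤ (C + 1) * (δ / (2 * (C + 1) * R)) * R := by gcongr; linarith
        _ = δ / 2 := by field_simp
      linarith
    · have hlim : charFun ((multivariateGaussian (0 : Param p₁ p₂ r) 1).map id) t =
          ((Real.exp (-(t.ofLp ⬝ᵥ t.ofLp) / 2) : ℝ) : ℂ) := by
        rw [Measure.map_id, charFun_multivariateGaussian PosSemidef.one]
        simp [neg_div]
      rw [hlim]
      set c : ℕ × ℕ → Fin p₂ × Fin p₁ → ℝ := fun N =>
        t.ofLp ᵥ* (T (ω N.1)⁻¹ (ι N.2)⁻¹ * lsPermMatrix r S₀ (ω N.1)⁻¹ (ι N.2)⁻¹) with hc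
      -- The coefficient vectors depend on N only through the permutations, so they take finitely
      -- many values and are bounded.
      obtain ⟨k, hk⟩ := Finite.exists_max
        fun k : (Equiv.Perm (Fin p₁) × Equiv.Perm (Fin p₂)) =>
          ‖t.ofLp ᵥ* (T k.1 k.2 * lsPermMatrix r S₀ k.1 k.2)‖
      refine (tendsto_integral_cexp_blockMean hw_pos hπ_pos hτ₀ hγ₀ hE_indep h3 hE_mean
        (sq_nonneg σ) hv (B := 12 * Real.exp (K / 2)) (by positivity)
        (fun N i j => integral_abs_pow_three_le (hE_subG N i j)) (c := c)
        (C := ‖t.ofLp ᵥ* (T k.1 k.2 * lsPermMatrix r S₀ k.1 k.2)‖)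
        (fun N a => (norm_le_pi_norm (c N) a).trans (hk ((ω N.1)⁻¹, (ι N.2)⁻¹)))
        (fun N => sum_sq_transpose_invSqrt_mulVec (hG _ _) _)).congr fun N => ?_
      refine integral_congr_ae (ae_of_all _ fun x => ?_)
      simp only [hX', hc]
      rw [real_inner_smul_left, inner_toLpLin_vecE]
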